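/- **Theorem 1 (Weak law of large numbers).** Let $m\ge 1$, let $\varepsilon_1<\dots<\varepsilon_m$ be real numbers, let $g_1,\dots,g_m>0$ with $\sum_i g_i=1$, and let $E\in\mathbb R$. Let $G(N)$, $N\ge 1$, be positive integers, non-decreasing in $N$ with $G(N)\to\infty$, such that $G_i:=g_iG(N)$ is an integer for all $i$ and $N$. Fix $r\in\{0,1\}$ and let $\Omega_{N,E}$ be the set of all $x=(N_1/N,\dots,N_m/N)$ with integers $N_i\ge r$, $\sum_i N_i=N$ and $\sum_i\varepsilon_iN_i\le EN$ (for $r=0$ empty levels are allowed; for $r=1$ all levels are occupied). Let $X_N$ be the random vector on $\Omega_{N,E}$ with $$\Pr(X_N=x)=\frac{e^{S(x,N)}}{Z(N,E)},\qquad S(x,N)=\ln\prod_{i=1}^m\frac{(x_iN+G_i-1)!}{(x_iN)!\,(G_i-1)!},\qquad Z(N,E)=\sum_{x\in\Omega_{N,E}}e^{S(x,N)}$$ (well defined for all large $N$ in the situations below). Put $\overline{g\varepsilon}=\sum_{i=1}^m g_i\varepsilon_i$ and consider the three cases $$1)\ \tfrac{G(N)}{N}\to\infty,\qquad 2)\ \tfrac{G(N)}{N}\to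 c\in(0,\infty),\qquad 3)\ \tfrac{G(N)}{N}\to 0.$$ If $\varepsilon_1<E<\overline{g\varepsilon}$ or $E\ge\overline{g\varepsilon}$, then in each case $X_N$ converges in distribution, as $N\to\infty$, to a constant vector $x^*$, where: a) If $\varepsilon_1<E<\overline{g\varepsilon}$, then for $i=1,\dots,m$ $$1)\ x_i^*=\frac{g_i}{e^{\lambda\varepsilon_i+\nu}},\qquad 2)\ x_i^*=\frac{g_i\,c}{e^{\lambda\varepsilon_i+\nu}-1},\qquad 3)\ x_i^*=\frac{g_i}{\lambda\varepsilon_i+\nu},$$ where $(\lambda,\nu)\in\mathbb R^2$ is the solution of $\sum_i x_i^*=1$, $\sum_i\varepsilon_ix_i^*=E$ for which all $x_i^*>0$; this solution exists and is unique. b) If $E\ge\overline{g\varepsilon}$, then $x_i^*=g_i$ for $i=1,\dots,m$. Further, let $M_{X_N}(\xi)=\mathbb E\,e^{\xi^TX_N}$, write $u\gg v$ for $u(N)/v(N)\to\infty$, and let $\epsilon\in(0,\min\{\frac1{2m},\frac16\})$. For every $\xi\in\mathbb R^m$, as $N\to\infty$, $$M_{X_N}(\xi)=e^{\xi^Tx^*}+O(u(N))\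 \text{ if } u\gg v,\qquad M_{X_N}(\xi)=e^{\xi^Tx^*}+O(v(N))\ \text{ if } v\gg u,$$ with 1) $u(N)=N^{-(1/2-3\epsilon)}$ and $v(N)=N/G(N)$; 2) $u(N)=N^{-(1/2-3\epsilon)}$ and $v(N)=c(N)$, for any positive decreasing function $c(N)$ with $G(N)/N=c+O(c(N))$; 3) $u(N)=G(N)^{-(1/2-3\epsilon)}$ and $v(N)=G(N)/N$. -/

import Mathlib

open MeasureTheory Filter Topology Asymptotics

noncomputable section

namespace BoseGas

/-- Occupation vectors `(N₁, …, N_m)` of the levels: integers `N_i ≥ r` with `∑ N_i = N` and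
`∑ ε_i N_i ≤ E N`.  For `r = 0` empty levels are allowed; for `r = 1` every level is occupied,
i.e. `N_i / N ∈ {1/N, 2/N, …, 1}`. -/
def occupations {m : ℕ} (r : ℕ) (ε : Fin m → ℝ) (E : ℝ) (N : ℕ) : Finset (Fin m → ℕ) :=
  open Classical in
  (Finset.piAntidiag Finset.univ N).filter
    (fun k => (∀ i, r ≤ k i) ∧ ∑ i, ε i * (k i : ℝ) ≤ E * (N : ℝ))

/-- The entropy `ln ∏ (N_i + G_i - 1)! / (N_i! (G_i - 1)!)` (used for `G_i ≥ 1` only). -/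
def entropy {m : ℕ} (d k : Fin m → ℕ) : ℝ :=
  Real.log (∏ i, ((k i + d i - 1).factorial : ℝ) / ((k i).factorial * (d i - 1).factorial))

/-- The partition function: the sum of `e^S` over the sample space. -/
def partitionFunction {m : ℕ} (r : ℕ) (ε : Fin m → ℝ) (E : ℝ) (d : Fin m → ℕ) (N : ℕ) : ℝ :=
  ∑ k ∈ occupations r ε E N, Real.exp (entropy d k)

/-- The law of `X_N = (N₁/N, …, N_m/N)`, with probability mass function `e^S / Z`. -/
def law {m : ℕ} (r : ℕ) (ε : Fin m → ℝ) (E : ℝ) (d : Fin m → ℕ) (N : ℕ) :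
    Measure (Fin m → ℝ) :=
  ∑ k ∈ occupations r ε E N,
    ENNReal.ofReal (Real.exp (entropy d k) / partitionFunction r ε E d N) •
      Measure.dirac (fun i => (k i : ℝ) / (N : ℝ))

instance {m : ℕ} (r : ℕ) (ε : Fin m → ℝ) (E : ℝ) (d : Fin m → ℕ) (N : ℕ) :
    IsFiniteMeasure (law r ε E d N) := by
  constructor
  simp only [law, Measure.coe_finsetSum, Finset.sum_apply, Measure.smul_apply, measure_univ,
    smul_eq_mul, mul_one]
  exact ENNReal.sum_lt_top.2 fun _ _ => ENNReal.ofReal_lt_top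

/-- A finite measure as an element of the space of finite measures with the weak topology. -/
def toFinite {m : ℕ} (μ : Measure (Fin m → ℝ)) [h : IsFiniteMeasure μ] :
    FiniteMeasure (Fin m → ℝ) := ⟨μ, h⟩

/-- Convergence in distribution of the laws `μ N` to the constant vector `x`: the `μ N` are
probability measures for all large `N` and converge weakly to the point mass at `x`. -/
def ConvergesToConst {m : ℕ} (μ : ℕ → Measure (Fin m → ℝ)) [∀ N, IsFiniteMeasure (μ N)]
    (x : Fin m → ℝ) : Prop :=
  (∀ᶠ N in atTop, IsProbabilityMeasure (μ N)) ∧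
    Tendsto (fun N => toFinite (μ N)) atTop (𝓝 (toFinite (Measure.dirac x)))

/-- The moment generating function of a random vector with law `μ`. -/
def vecMgf {m : ℕ} (μ : Measure (Fin m → ℝ)) (ξ : Fin m → ℝ) : ℝ :=
  ∫ x, Real.exp (∑ i, ξ i * x i) ∂μ

/-- `u ≫ v`, i.e. `u(N) / v(N) → ∞`. -/
def MuchLarger (u v : ℕ → ℝ) : Prop :=
  Tendsto (fun N => u N / v N) atTop atTop

/-- The moment generating functions converge pointwise to that of the constant `x`, with error
`O(u)` when `u ≫ v` and with error `O(v)` when `v ≫ u`. -/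
def MgfRate {m : ℕ} (μ : ℕ → Measure (Fin m → ℝ)) (x : Fin m → ℝ) (u v : ℕ → ℝ) : Prop :=
  ∀ ξ : Fin m → ℝ,
    (MuchLarger u v →
      (fun N => vecMgf (μ N) ξ - Real.exp (∑ i, ξ i * x i)) =O[atTop] u) ∧
    (MuchLarger v u →
      (fun N => vecMgf (μ N) ξ - Real.exp (∑ i, ξ i * x i)) =O[atTop] v)

/-- The constants `δ` allowed in the exponent `1/2 - 3δ` of the rates. -/
def rateConstants (m : ℕ) : Set ℝ := Set.Ioo 0 (min (1 / (2 * (m : ℝ))) (1 / 6))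

/-- Weak law when `G(N)/N → ∞`. -/
def WeakLawDilute {m : ℕ} (G : ℕ → ℕ) (μ : ℕ → Measure (Fin m → ℝ))
    [∀ N, IsFiniteMeasure (μ N)] (x : Fin m → ℝ) : Prop :=
  ConvergesToConst μ x ∧
    ∀ δ ∈ rateConstants m,
      MgfRate μ x (fun N => 1 / (N : ℝ) ^ (1 / 2 - 3 * δ)) (fun N => (N : ℝ) / (G N : ℝ))

/-- Weak law when `G(N)/N → c > 0`; the rate `w` is any positive decreasing function with
`G(N)/N = c + O(w(N))`. -/
def WeakLawBalanced {m : ℕ} (c : ℝ) (G : ℕ → ℕ) (μ : ℕ → Measure (Fin m → ℝ))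
    [∀ N, IsFiniteMeasure (μ N)] (x : Fin m → ℝ) : Prop :=
  ConvergesToConst μ x ∧
    ∀ w : ℕ → ℝ, (∀ N, 0 < w N) → Antitone w →
      (fun N => (G N : ℝ) / (N : ℝ) - c) =O[atTop] w →
      ∀ δ ∈ rateConstants m, MgfRate μ x (fun N => 1 / (N : ℝ) ^ (1 / 2 - 3 * δ)) w

/-- Weak law when `G(N)/N → 0`. -/
def WeakLawDense {m : ℕ} (G : ℕ → ℕ) (μ : ℕ → Measure (Fin m → ℝ))
    [∀ N, IsFiniteMeasure (μ N)] (x : Fin m → ℝ) : Prop :=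
  ConvergesToConst μ x ∧
    ∀ δ ∈ rateConstants m,
      MgfRate μ x (fun N => 1 / (G N : ℝ) ^ (1 / 2 - 3 * δ)) (fun N => (G N : ℝ) / (N : ℝ))

/-- Maxwell–Boltzmann statistics; `p = (λ, ν)`. -/
def maxwellBoltzmann {m : ℕ} (g ε : Fin m → ℝ) (p : ℝ × ℝ) : Fin m → ℝ :=
  fun i => g i / Real.exp (p.1 * ε i + p.2)

/-- Bose–Einstein statistics, for `c = lim G(N)/N`; `p = (λ, ν)`. -/
def boseEinstein {m : ℕ} (c : ℝ) (g ε : Fin m → ℝ) (p : ℝ × ℝ) : Fin m → ℝ :=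
  fun i => g i * c / (Real.exp (p.1 * ε i + p.2) - 1)

/-- Zipf–Mandelbrot law; `p = (λ, ν)`. -/
def zipfMandelbrot {m : ℕ} (g ε : Fin m → ℝ) (p : ℝ × ℝ) : Fin m → ℝ :=
  fun i => g i / (p.1 * ε i + p.2)

/-- `x` has positive entries and satisfies `∑ x_i = 1` and `∑ ε_i x_i = E`. -/
def SolvesConstraints {m : ℕ} (ε : Fin m → ℝ) (E : ℝ) (x : Fin m → ℝ) : Prop :=
  (∀ i, 0 < x i) ∧ ∑ i, x i = 1 ∧ ∑ i, ε i * x i = E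

end BoseGas

end

/-!
The weight `e^S = ∏ C(N_i + G_i - 1, N_i)` is a product of negative binomial weights. Multiplying it
by `∏ q_i ^ N_i` with `q_i = e^{-(λ ε_i + ν)}` changes it only by a constant and by the factor
`e^{λ (∑ ε_i N_i - E N)}` (`exp_entropy_eq_tilt`), which is at most `1` on the sample space when
`λ ≥ 0`. Hence `X_N` is a vector of independent negative binomial variables, conditioned on the
total number and on the energy constraint, with a density that is bounded by its value on the energy
boundary. The multipliers `λ, ν` are taken from the limiting statistics, rescaled with `N`: as they
stand for Bose–Einstein, with `ν` shifted by `log (G(N)/N)` for Maxwell–Boltzmann, and multiplied by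
`G(N)/N` for Zipf–Mandelbrot. The means are then `N x*_i` up to a relative error `v`, which is,
up to a constant factor, the second rate of the theorem, or `|G(N)/N - c|` when `G(N)/N → c > 0`. For `E ≥ ∑ g_i ε_i` the same holds with `λ = 0`, and in every case
complementary slackness `λ (E - ∑ ε_i x*_i) = 0` is all that is used.

Let `h` be `1`, or `N / G(N)` when `G(N)/N → 0`, and `s = N / h`. The probability of a deviation
larger than `t` is a quotient. Its numerator is bounded by Chernoff's inequality, after one
coordinate has been eliminated through `∑ N_i = N` (`sum_prod_negBin_le`). Its denominator is
bounded below by the `h^(m-1)` lattice points next to `N x*` that satisfy the constraints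
(`Regular.exists_box`), on which a Stirling bound applies (`le_negBin`). Powers of `h` cancel, so that
the quotient is at most `C s^m exp (C₂ s v² - c s t²)` (`Regular.tailProb_le`), however fast `N` grows
compared with `G(N)`. Taking `t` a multiple of `s^{-(1/2 - 3δ)} + v` makes this smaller than
any power of `s` (`exists_tailProb_le`), which gives the weak law and the rates
(`convergesToConst_and_mgfRate`).

The multipliers are unique because the occupation number is strictly decreasing in `λ ε + ν`, and
exist because they are the interior minimum of a convex function (`OccupationFunction.exists_solves`).
-/

namespace BoseGas

/-! ### The negative binomial distribution -/

/-- The negative binomial probability mass function: the probability that the sum of `d`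
independent geometric variables with ratio `q` equals `k`. -/
noncomputable def negBin (d : ℕ) (q : ℝ) (k : ℕ) : ℝ :=
  ((k + d - 1).choose k : ℝ) * q ^ k * (1 - q) ^ d

lemma negBin_nonneg {d : ℕ} {q : ℝ} (h0 : 0 ≤ q) (h1 : q ≤ 1) (k : ℕ) : 0 ≤ negBin d q k := by
  have : 0 ≤ 1 - q := by linarith
  unfold negBin
  positivity

lemma hasSum_choose_mul_pow {d : ℕ} (hd : 0 < d) {z : ℝ} (h0 : 0 ≤ z) (h1 : z < 1) :
    HasSum (fun k : ℕ => ((k + d - 1).choose k : ℝ) * z ^ k) (1 / (1 - z) ^ d) := by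
  obtain ⟨n, rfl⟩ : ∃ n, d = n + 1 := ⟨d - 1, by omega⟩
  have h := hasSum_choose_mul_geometric_of_norm_lt_one (𝕜 := ℝ) n (r := z)
    (by rw [Real.norm_of_nonneg h0]; exact h1)
  convert! h using 4 with k
  rw [show k + (n + 1) - 1 = k + n by omega, Nat.choose_symm_add]

/-- Dropping one of the `d` geometric factors: no value is likelier than `1 - q`. -/
lemma negBin_le_one_sub {d : ℕ} (hd : 0 < d) {q : ℝ} (h0 : 0 ≤ q) (h1 : q ≤ 1) (k : ℕ) :
    negBin d q k ≤ 1 - q := by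
  obtain ⟨n, rfl⟩ : ∃ n, d = n + 1 := ⟨d - 1, by omega⟩
  have h2 : 0 ≤ 1 - q := by linarith
  have key : ((k + n).choose k : ℝ) * q ^ k * (1 - q) ^ n ≤ 1 := by
    have hb := add_pow q (1 - q) (k + n)
    rw [add_sub_cancel, one_pow] at hb
    have := Finset.single_le_sum
      (f := fun m => q ^ m * (1 - q) ^ (k + n - m) * ((k + n).choose m : ℝ))
      (s := Finset.range (k + n + 1)) (fun i _ => by positivity)
      (Finset.mem_range.2 (by omega : k < k + n + 1))
    rw [← hb] at this
    refine le_trans (le_of_eq ?_) this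
    simp only [Nat.add_sub_cancel_left]
    ring
  unfold negBin
  rw [show k + (n + 1) - 1 = k + n by omega, pow_succ, ← mul_assoc]
  exact mul_le_of_le_one_left h2 key

lemma exp_one_sub_inv_le {y : ℝ} (hy : 0 < y) : Real.exp (1 - 1 / y) ≤ y := by
  have h := Real.add_one_le_exp (1 / y - 1)
  rw [show (1 : ℝ) - 1 / y = -(1 / y - 1) by ring, Real.exp_neg, inv_le_comm₀ (Real.exp_pos _) hy]
  rw [← one_div]
  linarith

lemma exp_neg_le_one_sub {y : ℝ} (hy : |y| ≤ 1 / 2) : Real.exp (-(y + 2 * y ^ 2)) ≤ 1 - y := by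
  obtain ⟨h1, h2⟩ := abs_le.1 hy
  have h3 : 0 < 1 - y := by linarith
  refine le_trans (Real.exp_le_exp.2 ?_) (exp_one_sub_inv_le h3)
  rw [neg_le_sub_iff_le_add, div_le_iff₀ h3]
  nlinarith [mul_nonneg (sq_nonneg y) (by linarith : 0 ≤ 1 - 2 * y)]

/-- A sub-Gaussian bound for the moment generating function of the negative binomial
distribution near `0`. -/
lemma sum_negBin_mul_exp_le {d : ℕ} (hd : 0 < d) {q μ θ : ℝ} (h0 : 0 < q) (h1 : q < 1)
    (hμ : μ * (1 - q) = d * q) (hθ : |θ| ≤ 1) (hθ' : 4 * μ * |θ| ≤ d) (s : Finset ℕ) :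
    ∑ k ∈ s, negBin d q k * Real.exp (θ * k) ≤
      Real.exp (θ * μ + (μ + 8 * μ ^ 2 / d) * θ ^ 2) := by
  have hd' : (0 : ℝ) < d := by exact_mod_cast hd
  have hq : 0 < 1 - q := by linarith
  have hμ0 : 0 < μ := by
    have : 0 < μ * (1 - q) := by rw [hμ]; positivity
    exact pos_of_mul_pos_left this hq.le
  have he2 : |Real.exp θ - 1| ≤ 2 * |θ| := Real.abs_exp_sub_one_le hθ
  have he1 : Real.exp θ - 1 - θ ≤ θ ^ 2 := (abs_le.1 (Real.abs_exp_sub_one_sub_id_le hθ)).2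
  set y : ℝ := μ / d * (Real.exp θ - 1) with hy
  have hyabs : |y| ≤ 2 * (μ / d) * |θ| := by
    rw [hy, abs_mul, abs_of_pos (by positivity)]
    calc μ / d * |Real.exp θ - 1| ≤ μ / d * (2 * |θ|) := by gcongr
      _ = _ := by ring
  have hyhalf : |y| ≤ 1 / 2 := by
    refine hyabs.trans ?_
    rw [show 2 * (μ / d) * |θ| = (2 * μ * |θ|) / d by ring, div_le_iff₀ hd']
    linarith
  have hz : 1 - q * Real.exp θ = (1 - q) * (1 - y) := by
    have : q = μ * (1 - q) / d := by rw [hμ]; field_simp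
    have h' : (1 - q) * y = q * (Real.exp θ - 1) := by
      rw [hy]
      nth_rewrite 2 [this]
      ring
    linarith
  have hy1 : 0 < 1 - y := by linarith [(abs_le.1 hyhalf).2]
  have hz1 : q * Real.exp θ < 1 := by
    have := mul_pos hq hy1
    linarith
  have hs := (hasSum_choose_mul_pow hd (by positivity : 0 ≤ q * Real.exp θ) hz1).mul_right
    ((1 - q) ^ d)
  have hle := sum_le_hasSum s (fun k _ => by positivity) hs
  calc ∑ k ∈ s, negBin d q k * Real.exp (θ * k)
      = ∑ k ∈ s, ((k + d - 1).choose k : ℝ) * (q * Real.exp θ) ^ k * (1 - q) ^ d := by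
        refine Finset.sum_congr rfl fun k _ => ?_
        rw [negBin, mul_pow, ← Real.exp_nat_mul, mul_comm θ]
        ring
    _ ≤ 1 / (1 - q * Real.exp θ) ^ d * (1 - q) ^ d := hle
    _ = (1 / (1 - y)) ^ d := by
        rw [hz, mul_pow, div_pow, one_pow]
        field_simp
    _ ≤ (Real.exp (y + 2 * y ^ 2)) ^ d := by
        gcongr
        rw [one_div, inv_le_comm₀ hy1 (Real.exp_pos _), ← Real.exp_neg]
        exact exp_neg_le_one_sub hyhalf
    _ = Real.exp (d * (y + 2 * y ^ 2)) := by rw [← Real.exp_nat_mul]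
    _ ≤ _ := by
        gcongr
        have h2 : y ^ 2 ≤ (2 * (μ / d) * |θ|) ^ 2 := by
          rw [← sq_abs y]
          gcongr
        have h3 : d * y = μ * (Real.exp θ - 1) := by rw [hy]; field_simp
        have h4 : d * (2 * (μ / d) * |θ|) ^ 2 = 4 * μ ^ 2 / d * θ ^ 2 := by
          rw [mul_pow, sq_abs]; field_simp; ring
        have h5 : d * y ^ 2 ≤ d * (2 * (μ / d) * |θ|) ^ 2 := by gcongr
        have h6 : μ * (Real.exp θ - 1 - θ) ≤ μ * θ ^ 2 := by gcongr
        rw [h4] at h5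
        have h7 : 8 * μ ^ 2 / d * θ ^ 2 = 2 * (4 * μ ^ 2 / d * θ ^ 2) := by ring
        linarith

lemma factorial_le_exp_mul_sqrt {n : ℕ} (hn : 0 < n) :
    (n.factorial : ℝ) ≤ Real.exp 1 * √n * (n / Real.exp 1) ^ n := by
  obtain ⟨k, rfl⟩ : ∃ k, n = k + 1 := ⟨n - 1, by omega⟩
  have h := Stirling.stirlingSeq'_antitone (Nat.zero_le k)
  simp only [Function.comp, Nat.succ_eq_add_one, zero_add, Stirling.stirlingSeq_one] at h
  rw [Stirling.stirlingSeq, div_le_div_iff₀ (by positivity) (by positivity)] at h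
  have h2 : √(2 * ((k + 1 : ℕ) : ℝ)) = √2 * √((k + 1 : ℕ) : ℝ) := Real.sqrt_mul (by norm_num) _
  rw [h2] at h
  have h3 : 0 < √(2 : ℝ) := by positivity
  nlinarith

lemma le_choose_add {k d : ℕ} (hk : 0 < k) (hd : 0 < d) :
    (k + d : ℝ) / (8 * k * d) * ((k + d : ℝ) ^ (k + d) / (k ^ k * d ^ d)) ≤
      ((k + d).choose k : ℝ) := by
  have hk' : (0 : ℝ) < k := by exact_mod_cast hk
  have hd' : (0 : ℝ) < d := by exact_mod_cast hd
  have hk1 : (1 : ℝ) ≤ k := by exact_mod_cast hk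
  have hd1 : (1 : ℝ) ≤ d := by exact_mod_cast hd
  have h1 := Stirling.le_factorial_stirling (k + d)
  have h2 := factorial_le_exp_mul_sqrt hk
  have h3 := factorial_le_exp_mul_sqrt hd
  have hc : ((k + d).choose k : ℝ) = (k + d).factorial / (k.factorial * d.factorial) := by
    rw [Nat.cast_choose ℝ (Nat.le_add_right k d), Nat.add_sub_cancel_left]
  rw [hc, le_div_iff₀ (by positivity)]
  push_cast at h1
  have he : Real.exp 1 ^ 2 ≤ 8 := by
    have := Real.exp_one_lt_d9
    have := Real.exp_pos 1
    nlinarith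
  have hsq : (k + d : ℝ) * Real.exp 1 ^ 2 * (√k * √d) ≤ 8 * k * d * √(2 * Real.pi * (k + d)) := by
    have hroot : (k + d : ℝ) * (√k * √d) ≤ k * d * √(2 * Real.pi * (k + d)) := by
      refine abs_le_of_sq_le_sq' ?_ (by positivity) |>.2
      rw [mul_pow, mul_pow, mul_pow, Real.sq_sqrt hk'.le, Real.sq_sqrt hd'.le,
        Real.sq_sqrt (by positivity)]
      have h4 : (k + d : ℝ) ≤ k * d * (2 * Real.pi) := by
        have := Real.pi_gt_three
        nlinarith [mul_nonneg (sub_nonneg.2 hk1) (sub_nonneg.2 hd1),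
          mul_pos (mul_pos hk' hd') (by linarith : 0 < Real.pi - 3)]
      calc (k + d : ℝ) ^ 2 * (k * d) = (k * d * (k + d)) * (k + d) := by ring
        _ ≤ (k * d * (k + d)) * (k * d * (2 * Real.pi)) := by gcongr
        _ = _ := by ring
    calc (k + d : ℝ) * Real.exp 1 ^ 2 * (√k * √d)
        = Real.exp 1 ^ 2 * ((k + d : ℝ) * (√k * √d)) := by ring
      _ ≤ 8 * (k * d * √(2 * Real.pi * (k + d))) := by gcongr
      _ = _ := by ring
  calc _ ≤ (k + d : ℝ) / (8 * k * d) * ((k + d : ℝ) ^ (k + d) / (k ^ k * d ^ d)) *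
        ((Real.exp 1 * √k * (k / Real.exp 1) ^ k) * (Real.exp 1 * √d * (d / Real.exp 1) ^ d)) := by
        gcongr
    _ = ((k + d : ℝ) * Real.exp 1 ^ 2 * (√k * √d)) / (8 * k * d) *
        ((k + d) / Real.exp 1) ^ (k + d) := by
        simp only [div_pow, pow_add]
        field_simp
    _ ≤ √(2 * Real.pi * (k + d)) * ((k + d) / Real.exp 1) ^ (k + d) := by
        gcongr
        rw [div_le_iff₀ (by positivity)]
        linarith
    _ ≤ _ := h1

/-- A Gaussian lower bound for the negative binomial distribution with mean `μ`. -/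
lemma le_negBin {d k : ℕ} (hd : 0 < d) (hk : 0 < k) {q μ : ℝ} (h0 : 0 < q) (h1 : q < 1)
    (hμ : μ * (1 - q) = d * q) :
    1 / (8 * k) * Real.exp (-(d / (k + d) * (k - μ) ^ 2 / μ)) ≤ negBin d q k := by
  have hk' : (0 : ℝ) < k := by exact_mod_cast hk
  have hd' : (0 : ℝ) < d := by exact_mod_cast hd
  have hq : 0 < 1 - q := by linarith
  have hμ0 : 0 < μ := by
    have : 0 < μ * (1 - q) := by rw [hμ]; positivity
    exact pos_of_mul_pos_left this hq.le
  have hc : ((k + d - 1).choose k : ℝ) = d / (k + d) * ((k + d).choose k : ℝ) := by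
    obtain ⟨n, rfl⟩ : ∃ n, d = n + 1 := ⟨d - 1, by omega⟩
    have h := Nat.choose_mul_succ_eq (k + n) k
    rw [show k + n + 1 - k = n + 1 by omega] at h
    have h' : ((k + n).choose k : ℝ) * (k + n + 1) = ((k + n + 1).choose k : ℝ) * (n + 1) := by
      exact_mod_cast h
    rw [show k + (n + 1) - 1 = k + n by omega, ← add_assoc, div_mul_eq_mul_div,
      eq_div_iff (by positivity)]
    push_cast
    linarith
  have e1 := exp_one_sub_inv_le (y := (k + d) * q / k) (by positivity)
  have e2 := exp_one_sub_inv_le (y := (k + d) * (1 - q) / d) (by positivity)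
  have hexp : Real.exp (-(d / (k + d) * (k - μ) ^ 2 / μ)) ≤
      ((k + d) * q / k) ^ k * ((k + d) * (1 - q) / d) ^ d := by
    calc _ = Real.exp (1 - 1 / ((k + d) * q / k)) ^ k *
          Real.exp (1 - 1 / ((k + d) * (1 - q) / d)) ^ d := by
          rw [← Real.exp_nat_mul, ← Real.exp_nat_mul, ← Real.exp_add]
          congr 1
          have hqe : q = μ / (μ + d) := by
            rw [eq_div_iff (by positivity)]; linarith
          have hqe' : 1 - q = d / (μ + d) := by
            rw [hqe]; field_simp; ring
          rw [hqe', hqe]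
          field_simp
          ring
      _ ≤ _ := by gcongr
  calc _ ≤ 1 / (8 * k) * (((k + d) * q / k) ^ k * ((k + d) * (1 - q) / d) ^ d) := by gcongr
    _ = d / (k + d) * ((k + d : ℝ) / (8 * k * d) * ((k + d : ℝ) ^ (k + d) / (k ^ k * d ^ d))) *
        q ^ k * (1 - q) ^ d := by
        simp only [div_pow, mul_pow, pow_add]
        field_simp
    _ ≤ d / (k + d) * ((k + d).choose k : ℝ) * q ^ k * (1 - q) ^ d := by
        gcongr
        exact le_choose_add hk hd
    _ = _ := by rw [negBin, hc]

/-! ### Occupation vectors as conditioned negative binomial vectors -/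

lemma mem_occupations {m r N : ℕ} {ε : Fin m → ℝ} {E : ℝ} {k : Fin m → ℕ} :
    k ∈ occupations r ε E N ↔
      ∑ i, k i = N ∧ (∀ i, r ≤ k i) ∧ ∑ i, ε i * (k i : ℝ) ≤ E * (N : ℝ) := by
  simp [occupations]

lemma exp_entropy {m : ℕ} {d : Fin m → ℕ} (hd : ∀ l, 0 < d l) (k : Fin m → ℕ) :
    Real.exp (entropy d k) = ∏ l, ((k l + d l - 1).choose (k l) : ℝ) := by
  rw [entropy, Real.exp_log (Finset.prod_pos fun i _ => by positivity)]
  refine Finset.prod_congr rfl fun l _ => ?_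
  have := hd l
  rw [Nat.cast_choose ℝ (show k l ≤ k l + d l - 1 by omega),
    show k l + d l - 1 - k l = d l - 1 by omega]

/-- The ratio `e^{-(λ ε_l + ν)}` of the geometric law attached to level `l`. -/
noncomputable def levelRatio {m : ℕ} (ε : Fin m → ℝ) (lam nu : ℝ) (l : Fin m) : ℝ :=
  Real.exp (-(lam * ε l + nu))

lemma levelRatio_pos {m : ℕ} (ε : Fin m → ℝ) (lam nu : ℝ) (l : Fin m) :
    0 < levelRatio ε lam nu l := Real.exp_pos _

/-- The mean of the negative binomial law attached to level `l`. -/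
noncomputable def levelMean {m : ℕ} (ε : Fin m → ℝ) (d : Fin m → ℕ) (lam nu : ℝ) (l : Fin m) : ℝ :=
  d l * levelRatio ε lam nu l / (1 - levelRatio ε lam nu l)

/-- Exponential tilting: on `∑ k_l = N` the weight `e^S` is, up to a constant factor, a product of
negative binomial probabilities times `e^{λ (∑ ε_l k_l - E N)}`. -/
lemma exp_entropy_eq_tilt {m N : ℕ} {ε : Fin m → ℝ} {d k : Fin m → ℕ} (E : ℝ) {lam nu : ℝ}
    (hd : ∀ l, 0 < d l) (hq : ∀ l, levelRatio ε lam nu l < 1) (hk : ∑ l, k l = N) :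
    Real.exp (entropy d k) =
      Real.exp (N * (lam * E + nu)) / (∏ l, (1 - levelRatio ε lam nu l) ^ d l) *
        (Real.exp (lam * (∑ l, ε l * (k l : ℝ) - E * N)) *
          ∏ l, negBin (d l) (levelRatio ε lam nu l) (k l)) := by
  have hpos : 0 < ∏ l, (1 - levelRatio ε lam nu l) ^ d l :=
    Finset.prod_pos fun l _ => pow_pos (sub_pos.2 (hq l)) _
  have hkN : (N : ℝ) = ∑ l, (k l : ℝ) := by rw [← hk]; push_cast; rfl
  have hprod : ∏ l, levelRatio ε lam nu l ^ k l =
      Real.exp (-(lam * ∑ l, ε l * (k l : ℝ) + nu * N)) := by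
    simp only [levelRatio, ← Real.exp_nat_mul, ← Real.exp_sum]
    rw [hkN, Finset.mul_sum, Finset.mul_sum, ← Finset.sum_add_distrib, ← Finset.sum_neg_distrib]
    congr 1
    exact Finset.sum_congr rfl fun l _ => by ring
  have hone : Real.exp (N * (lam * E + nu)) * (Real.exp (lam * (∑ l, ε l * (k l : ℝ) - E * N)) *
      Real.exp (-(lam * ∑ l, ε l * (k l : ℝ) + nu * N))) = 1 := by
    rw [← Real.exp_add, ← Real.exp_add, ← Real.exp_zero]
    congr 1
    ring
  simp only [negBin, Finset.prod_mul_distrib]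
  rw [← exp_entropy hd, hprod, div_mul_eq_mul_div, eq_div_iff hpos.ne']
  linear_combination (-(Real.exp (entropy d k) * ∏ l, (1 - levelRatio ε lam nu l) ^ d l)) * hone

/-- On `∑ k_l = N` the coordinate `k_j` is a function of the others, so a sum of products is at
most the product of the sums over the coordinates `l ≠ j`, times the maximum of the factor `j`. -/
lemma sum_prod_le_of_sum_eq {m N : ℕ} {S : Finset (Fin m → ℕ)} (hS : ∀ k ∈ S, ∑ l, k l = N)
    (F : Fin m → ℕ → ℝ) (hF : ∀ l n, 0 ≤ F l n) (j : Fin m) {a : ℝ} (ha : ∀ n, F j n ≤ a) :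
    ∑ k ∈ S, ∏ l, F l (k l) ≤
      a * ∏ l ∈ Finset.univ.erase j, ∑ n ∈ Finset.range (N + 1), F l n := by
  classical
  have ha0 : 0 ≤ a := (hF j 0).trans (ha 0)
  set F' : Fin m → ℕ → ℝ := Function.update F j (fun _ => 1) with hF'
  have hF'0 : ∀ l n, 0 ≤ F' l n := by
    intro l n
    by_cases hl : l = j
    · subst hl; simp [hF']
    · simp [hF', hl, hF]
  set H : Fin m → Finset ℕ := fun l => if l = j then {0} else Finset.range (N + 1) with hH
  have hprod : ∀ k : Fin m → ℕ, ∏ l ∈ Finset.univ.erase j, F l (k l) =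
      ∏ l, F' l (Function.update k j 0 l) := by
    intro k
    rw [← Finset.mul_prod_erase Finset.univ _ (Finset.mem_univ j)]
    simp only [hF', Function.update_self, one_mul]
    refine Finset.prod_congr rfl fun l hl => ?_
    rw [Function.update_of_ne (Finset.ne_of_mem_erase hl),
      Function.update_of_ne (Finset.ne_of_mem_erase hl)]
  have hinj : Set.InjOn (fun k : Fin m → ℕ => Function.update k j 0) S := by
    intro k hk k' hk' hkk
    have hne : ∀ l, l ≠ j → k l = k' l := by
      intro l hl
      have := congrFun hkk l
      simpa [hl] using this
    have h1 := hS k hk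
    rw [← hS k' hk', ← Finset.add_sum_erase _ _ (Finset.mem_univ j),
      ← Finset.add_sum_erase _ k' (Finset.mem_univ j),
      Finset.sum_congr rfl fun l hl => hne l (Finset.ne_of_mem_erase hl)] at h1
    ext l
    by_cases hl : l = j
    · subst hl; exact Nat.add_right_cancel h1
    · exact hne l hl
  calc ∑ k ∈ S, ∏ l, F l (k l) ≤ ∑ k ∈ S, a * ∏ l, F' l (Function.update k j 0 l) := by
        refine Finset.sum_le_sum fun k _ => ?_
        rw [← hprod, ← Finset.mul_prod_erase Finset.univ _ (Finset.mem_univ j)]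
        exact mul_le_mul_of_nonneg_right (ha _) (Finset.prod_nonneg fun l _ => hF _ _)
    _ = a * ∑ y ∈ S.image (fun k : Fin m → ℕ => Function.update k j 0), ∏ l, F' l (y l) := by
        rw [← Finset.mul_sum, Finset.sum_image hinj]
    _ ≤ a * ∑ y ∈ Fintype.piFinset H, ∏ l, F' l (y l) := by
        refine mul_le_mul_of_nonneg_left (Finset.sum_le_sum_of_subset_of_nonneg ?_
          fun y _ _ => Finset.prod_nonneg fun l _ => hF'0 _ _) ha0
        intro y hy
        obtain ⟨k, hk, rfl⟩ := Finset.mem_image.1 hy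
        rw [Fintype.mem_piFinset]
        intro l
        by_cases hl : l = j
        · subst hl; simp [hH]
        · have : k l ≤ ∑ l, k l := Finset.single_le_sum (fun _ _ => Nat.zero_le _)
            (Finset.mem_univ l)
          rw [hS k hk] at this
          simp [hH, hl]
          omega
    _ = _ := by
        rw [← Finset.prod_univ_sum, ← Finset.mul_prod_erase Finset.univ _ (Finset.mem_univ j)]
        congr 1
        simp only [hF', hH, Function.update_self, if_true, Finset.sum_singleton, one_mul]
        refine Finset.prod_congr rfl fun l hl => ?_
        rw [Function.update_of_ne (Finset.ne_of_mem_erase hl), if_neg (Finset.ne_of_mem_erase hl)]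

/-- Chernoff's bound for the coordinate `i`, on a set where `θ k_i ≥ b`. -/
lemma sum_prod_negBin_le {m N : ℕ} {S : Finset (Fin m → ℕ)} (hS : ∀ k ∈ S, ∑ l, k l = N)
    {d : Fin m → ℕ} (hd : ∀ l, 0 < d l) {q μ : Fin m → ℝ} (hq0 : ∀ l, 0 < q l)
    (hq1 : ∀ l, q l < 1) (hμ : ∀ l, μ l * (1 - q l) = d l * q l) {i j : Fin m} (hij : i ≠ j)
    {θ b : ℝ} (hθ : |θ| ≤ 1) (hθ' : 4 * μ i * |θ| ≤ d i) (hb : ∀ k ∈ S, b ≤ θ * k i) :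
    ∑ k ∈ S, ∏ l, negBin (d l) (q l) (k l) ≤
      (1 - q j) * Real.exp (θ * μ i + (μ i + 8 * μ i ^ 2 / d i) * θ ^ 2 - b) := by
  classical
  have hnb : ∀ l n, 0 ≤ negBin (d l) (q l) n := fun l n => negBin_nonneg (hq0 l).le (hq1 l).le n
  set F : Fin m → ℕ → ℝ := fun l n =>
    negBin (d l) (q l) n * (if l = i then Real.exp (θ * n) else 1) with hF
  have hF0 : ∀ l n, 0 ≤ F l n := by
    intro l n
    refine mul_nonneg (hnb l n) ?_
    split_ifs <;> positivity
  have hFprod : ∀ k : Fin m → ℕ, ∏ l, F l (k l) =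
      (∏ l, negBin (d l) (q l) (k l)) * Real.exp (θ * k i) := by
    intro k
    simp only [hF, Finset.prod_mul_distrib]
    simp
  have hsum := sum_prod_le_of_sum_eq hS F hF0 j (a := 1 - q j) (by
    intro n
    simp only [hF, if_neg hij.symm, mul_one]
    exact negBin_le_one_sub (hd j) (hq0 j).le (hq1 j).le n)
  have herase : ∏ l ∈ Finset.univ.erase j, ∑ n ∈ Finset.range (N + 1), F l n ≤
      Real.exp (θ * μ i + (μ i + 8 * μ i ^ 2 / d i) * θ ^ 2) := by
    rw [← Finset.mul_prod_erase _ _ (Finset.mem_erase.2 ⟨hij, Finset.mem_univ i⟩)]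
    refine (mul_le_of_le_one_right (Finset.sum_nonneg fun n _ => hF0 _ _) ?_).trans ?_
    · refine Finset.prod_le_one (fun l _ => Finset.sum_nonneg fun n _ => hF0 _ _) fun l hl => ?_
      have hli : l ≠ i := Finset.ne_of_mem_erase hl
      have h := sum_negBin_mul_exp_le (θ := 0) (hd l) (hq0 l) (hq1 l) (hμ l) (by simp) (by simp)
        (Finset.range (N + 1))
      simpa [hF, hli] using h
    · simpa [hF] using
        sum_negBin_mul_exp_le (hd i) (hq0 i) (hq1 i) (hμ i) hθ hθ' (Finset.range (N + 1))
  calc ∑ k ∈ S, ∏ l, negBin (d l) (q l) (k l)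
      ≤ ∑ k ∈ S, Real.exp (-b) * ∏ l, F l (k l) := by
        refine Finset.sum_le_sum fun k hk => ?_
        rw [hFprod, mul_left_comm, ← Real.exp_add]
        refine le_mul_of_one_le_right (Finset.prod_nonneg fun l _ => hnb _ _) ?_
        exact Real.one_le_exp (by linarith [hb k hk])
    _ = Real.exp (-b) * ∑ k ∈ S, ∏ l, F l (k l) := by rw [Finset.mul_sum]
    _ ≤ Real.exp (-b) * ((1 - q j) * Real.exp (θ * μ i + (μ i + 8 * μ i ^ 2 / d i) * θ ^ 2)) := by
        refine mul_le_mul_of_nonneg_left (hsum.trans ?_) (Real.exp_pos _).le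
        exact mul_le_mul_of_nonneg_left herase (sub_pos.2 (hq1 j)).le
    _ = _ := by
        rw [sub_eq_add_neg _ b, Real.exp_add _ (-b)]
        ring

/-! ### Deviation bounds at a fixed number of particles -/

/-- The situation at a fixed `N`: `x` is the candidate limit, the parameters `lam`, `nu` of the
tilted negative binomial laws have means within `N v` of `N x` and satisfy complementary slackness
with the energy constraint. The width `h ≥ 1` is the number of neighbouring lattice points on which
the tilted weights are comparable (`1` unless `G(N)/N → 0`, and `N / G(N)` in that case), so that
`N / h` is the large parameter. The constants `κ` and `K` do not depend on `N`. -/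
structure Regular {m : ℕ} (κ K : ℝ) (ε : Fin m → ℝ) (E : ℝ) (x : Fin m → ℝ) (d : Fin m → ℕ)
    (N : ℕ) (h lam nu v : ℝ) : Prop where
  pos_m : 0 < m
  pos_κ : 0 < κ
  one_le_K : 1 ≤ K
  d_pos : ∀ l, 0 < d l
  one_le_h : 1 ≤ h
  le_x : ∀ l, κ ≤ x l
  sum_x : ∑ l, x l = 1
  energy : ∑ l, ε l * x l ≤ E
  lam_nonneg : 0 ≤ lam
  /-- Complementary slackness. -/
  slack : lam * (E - ∑ l, ε l * x l) = 0
  lam_mul_h : lam * h ≤ K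
  ratio_lt_one : ∀ l, levelRatio ε lam nu l < 1
  mean : ∀ l, |levelMean ε d lam nu l - N * x l| ≤ N * v
  v_le : v ≤ κ / 2
  /-- A level of size `d` holding `k` of order `N` particles has `d / (k + d) = O(1 / h)`. -/
  width_le : ∀ l, h * d l ≤ N + d l
  /-- The variances of the tilted laws are `O(N h)`. -/
  le_width : ∀ l, (N : ℝ) ≤ K * h * d l
  /-- There is room for the lattice points within `2 m h` of `N x`. -/
  size : 4 * m * h ≤ κ * N

namespace Regular

variable {m : ℕ} {κ K : ℝ} {ε : Fin m → ℝ} {E : ℝ} {x : Fin m → ℝ} {d : Fin m → ℕ}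
    {N : ℕ} {h lam nu v : ℝ}

lemma x_le_one (R : Regular κ K ε E x d N h lam nu v) (l : Fin m) : x l ≤ 1 := by
  rw [← R.sum_x]
  exact Finset.single_le_sum (fun i _ => R.pos_κ.le.trans (R.le_x i)) (Finset.mem_univ l)

lemma κ_le_one (R : Regular κ K ε E x d N h lam nu v) : κ ≤ 1 :=
  (R.le_x ⟨0, R.pos_m⟩).trans (R.x_le_one _)

lemma pos_N (R : Regular κ K ε E x d N h lam nu v) : (0 : ℝ) < N := by
  have h1 : (1 : ℝ) ≤ m := by exact_mod_cast R.pos_m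
  have h2 : 0 < κ * N := lt_of_lt_of_le (by nlinarith [R.one_le_h]) R.size
  exact pos_of_mul_pos_right h2 R.pos_κ.le

lemma four_mul_h_le (R : Regular κ K ε E x d N h lam nu v) : 4 * h ≤ κ * N := by
  have h1 : (1 : ℝ) ≤ m := by exact_mod_cast R.pos_m
  nlinarith [R.one_le_h, R.size]

lemma h_le_N (R : Regular κ K ε E x d N h lam nu v) : h ≤ N := by
  nlinarith [R.four_mul_h_le, R.κ_le_one, R.pos_N, R.one_le_h]

lemma mean_eq (R : Regular κ K ε E x d N h lam nu v) (l : Fin m) :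
    levelMean ε d lam nu l * (1 - levelRatio ε lam nu l) = d l * levelRatio ε lam nu l :=
  div_mul_cancel₀ _ (sub_pos.2 (R.ratio_lt_one l)).ne'

lemma le_mean (R : Regular κ K ε E x d N h lam nu v) (l : Fin m) :
    κ / 2 * N ≤ levelMean ε d lam nu l := by
  have := (abs_le.1 (R.mean l)).1
  nlinarith [R.le_x l, R.v_le, R.pos_N]

lemma mean_le (R : Regular κ K ε E x d N h lam nu v) (l : Fin m) :
    levelMean ε d lam nu l ≤ 2 * N := by
  have := (abs_le.1 (R.mean l)).2
  nlinarith [R.x_le_one l, R.v_le, R.pos_N, R.κ_le_one]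

lemma mean_pos (R : Regular κ K ε E x d N h lam nu v) (l : Fin m) :
    0 < levelMean ε d lam nu l :=
  lt_of_lt_of_le (mul_pos (by linarith [R.pos_κ]) R.pos_N) (R.le_mean l)

/-- A level of size `d` holding at least `κ N / 2` particles has `d / (k + d) = O(1 / h)`. -/
lemma div_add_le (R : Regular κ K ε E x d N h lam nu v) (l : Fin m) {k : ℝ}
    (hk : κ / 2 * N ≤ k) : d l / (k + d l) ≤ 2 / κ / h := by
  have hd : (0 : ℝ) < d l := by exact_mod_cast R.d_pos l
  have hh : 0 < h := by linarith [R.one_le_h]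
  have hκ := R.pos_κ
  have hk0 : 0 < k := lt_of_lt_of_le (mul_pos (by linarith) R.pos_N) hk
  rw [div_div, div_le_div_iff₀ (by positivity) (by positivity)]
  have h1 : κ * (h * d l) ≤ κ * (N + d l) := mul_le_mul_of_nonneg_left (R.width_le l) hκ.le
  nlinarith [R.κ_le_one]

lemma one_sub_ratio_le (R : Regular κ K ε E x d N h lam nu v) (l : Fin m) :
    1 - levelRatio ε lam nu l ≤ 2 / κ / h := by
  have hd : (0 : ℝ) < d l := by exact_mod_cast R.d_pos l
  have hμ := R.mean_pos l
  refine le_trans (le_of_eq ?_) (R.div_add_le l (R.le_mean l))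
  rw [eq_div_iff (by positivity)]
  linarith [R.mean_eq l]

/-- The normalizing constant of the exponential tilt. -/
noncomputable def tiltConst {m : ℕ} (ε : Fin m → ℝ) (E : ℝ) (d : Fin m → ℕ) (N : ℕ)
    (lam nu : ℝ) : ℝ :=
  Real.exp (N * (lam * E + nu)) / ∏ l, (1 - levelRatio ε lam nu l) ^ d l

lemma tiltConst_pos (R : Regular κ K ε E x d N h lam nu v) : 0 < tiltConst ε E d N lam nu :=
  div_pos (Real.exp_pos _) (Finset.prod_pos fun l _ => pow_pos (sub_pos.2 (R.ratio_lt_one l)) _)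

/-- The weight of the configurations in which level `i` deviates by more than `t` to a given side;
`σ = ±1` is the side. -/
lemma sum_one_sided_le (R : Regular κ K ε E x d N h lam nu v) {r : ℕ} {t σ : ℝ}
    (ht : 2 * v ≤ t) (ht0 : 0 ≤ t) (ht1 : t ≤ 1) (hσ : |σ| = 1) {i j : Fin m} (hij : i ≠ j)
    {S : Finset (Fin m → ℕ)} (hS : S ⊆ occupations r ε E N)
    (hdev : ∀ k ∈ S, N * t ≤ σ * (k i - N * x i)) :
    ∑ k ∈ S, Real.exp (entropy d k) ≤ tiltConst ε E d N lam nu *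
      (2 / κ / h * Real.exp (-(N / h * t ^ 2 / (544 * K)))) := by
  have hh : 0 < h := by linarith [R.one_le_h]
  have hdi : (0 : ℝ) < d i := by exact_mod_cast R.d_pos i
  have hN := R.pos_N
  obtain ⟨P, hPdef⟩ : ∃ P, P = K * h := ⟨_, rfl⟩
  have hP : 1 ≤ P := hPdef ▸ one_le_mul_of_one_le_of_one_le R.one_le_K R.one_le_h
  have hP0 : 0 < P := by linarith
  have hPd : N ≤ P * d i := hPdef ▸ R.le_width i
  set M := levelMean ε d lam nu i with hM
  have hM0 : 0 < M := R.mean_pos i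
  have hM2 : M ≤ 2 * N := R.mean_le i
  set τ := t / (136 * P) with hτ
  have hτ0 : 0 ≤ τ := by positivity
  have hPτ : P * τ = t / 136 := by rw [hτ]; field_simp
  -- The nearly optimal exponent: the variance of the tilted law is of order `N h`.
  have hθabs : |σ * τ| = τ := by rw [abs_mul, hσ, one_mul, abs_of_nonneg hτ0]
  have hτ1 : τ ≤ 1 := by
    rw [hτ, div_le_one (by positivity)]
    linarith
  have hV : M + 8 * M ^ 2 / d i ≤ 34 * P * N := by
    have e1 : 8 * M ^ 2 / d i ≤ 32 * P * N := by
      rw [div_le_iff₀ hdi]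
      calc 8 * M ^ 2 ≤ 8 * (2 * N) ^ 2 := by gcongr
        _ = 32 * (N : ℝ) * N := by ring
        _ ≤ 32 * (N : ℝ) * (P * d i) := by gcongr
        _ = _ := by ring
    nlinarith
  have hsum := sum_prod_negBin_le (S := S) (N := N) (d := d) (q := levelRatio ε lam nu)
    (μ := levelMean ε d lam nu) (fun k hk => (mem_occupations.1 (hS hk)).1) R.d_pos
    (levelRatio_pos ε lam nu) R.ratio_lt_one R.mean_eq hij (θ := σ * τ)
    (b := σ * τ * (N * x i) + τ * (N * t)) (by rw [hθabs]; exact hτ1) (by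
      rw [hθabs, ← hM]
      calc 4 * M * τ ≤ 4 * (2 * N) * τ := by gcongr
        _ ≤ 4 * (2 * (P * d i)) * τ := by gcongr
        _ = 8 * d i * (P * τ) := by ring
        _ ≤ d i := by rw [hPτ]; nlinarith)
    (by
      intro k hk
      have := mul_le_mul_of_nonneg_left (hdev k hk) hτ0
      linarith)
  have hexp : σ * τ * M + (M + 8 * M ^ 2 / d i) * (σ * τ) ^ 2 -
      (σ * τ * (N * x i) + τ * (N * t)) ≤ -(N / h * t ^ 2 / (544 * K)) := by
    have e1 : σ * (M - N * x i) ≤ N * t / 2 := by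
      refine (le_abs_self _).trans ?_
      rw [abs_mul, hσ, one_mul]
      refine (R.mean i).trans ?_
      nlinarith
    have e2 : (M + 8 * M ^ 2 / d i) * (σ * τ) ^ 2 ≤ τ * (N * t) / 4 := by
      rw [← sq_abs (σ * τ), hθabs]
      calc (M + 8 * M ^ 2 / d i) * τ ^ 2 ≤ 34 * P * N * τ ^ 2 := by gcongr
        _ = 34 * N * τ * (P * τ) := by ring
        _ = _ := by rw [hPτ]; ring
    have e3 : N / h * t ^ 2 / (544 * K) = τ * (N * t) / 4 := by
      rw [hτ, hPdef]
      have := R.one_le_K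
      field_simp
      ring
    rw [e3]
    have := mul_le_mul_of_nonneg_left e1 hτ0
    linarith
  calc ∑ k ∈ S, Real.exp (entropy d k)
      ≤ ∑ k ∈ S, tiltConst ε E d N lam nu *
          ∏ l, negBin (d l) (levelRatio ε lam nu l) (k l) := by
        refine Finset.sum_le_sum fun k hk => ?_
        obtain ⟨hkN, -, hkE⟩ := mem_occupations.1 (hS hk)
        rw [exp_entropy_eq_tilt E R.d_pos R.ratio_lt_one hkN, ← tiltConst]
        refine mul_le_mul_of_nonneg_left ?_ R.tiltConst_pos.le
        refine mul_le_of_le_one_left (Finset.prod_nonneg fun l _ =>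
          negBin_nonneg (levelRatio_pos ε lam nu l).le (R.ratio_lt_one l).le _) ?_
        exact Real.exp_le_one_iff.2
          (mul_nonpos_of_nonneg_of_nonpos R.lam_nonneg (sub_nonpos.2 hkE))
    _ = tiltConst ε E d N lam nu *
          ∑ k ∈ S, ∏ l, negBin (d l) (levelRatio ε lam nu l) (k l) := by rw [Finset.mul_sum]
    _ ≤ _ := by
        refine mul_le_mul_of_nonneg_left (hsum.trans ?_) R.tiltConst_pos.le
        have := R.pos_κ
        exact mul_le_mul (R.one_sub_ratio_le j) (Real.exp_le_exp.2 hexp) (Real.exp_pos _).le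
          (by positivity)

/-- The lattice points next to `N x` in the polytope: every level but the lowest one gives up at
most `h + 1` particles, and the lowest level takes them, which can only decrease the energy. -/
lemma exists_box (R : Regular κ K ε E x d N h lam nu v) (hε : StrictMono ε) {r : ℕ} (hr : r ≤ 1) :
    ∃ S : Finset (Fin m → ℕ), S ⊆ occupations r ε E N ∧ h ^ (m - 1) ≤ (S.card : ℝ) ∧
      ∀ k ∈ S, ∀ l, |(k l : ℝ) - N * x l| ≤ 2 * m * h ∧ κ / 2 * N ≤ k l := by
  classical
  have hN := R.pos_N
  have hh := R.one_le_h
  have hκ := R.pos_κ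
  have hm1 : (1 : ℝ) ≤ m := by exact_mod_cast R.pos_m
  have h4 := R.four_mul_h_le
  set i₀ : Fin m := ⟨0, R.pos_m⟩ with hi₀
  set J := ⌊h⌋₊ with hJ
  have hJh : (J : ℝ) ≤ h := Nat.floor_le (by linarith)
  set n : Fin m → ℕ := fun l => ⌊N * x l⌋₊ with hn
  have hNx : ∀ l, κ * N ≤ N * x l := fun l => by nlinarith [R.le_x l]
  have hn1 : ∀ l, (n l : ℝ) ≤ N * x l := fun l =>
    Nat.floor_le (by nlinarith [hNx l])
  have hn2 : ∀ l, N * x l - 1 < n l := fun l => by linarith [Nat.lt_floor_add_one (N * x l)]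
  set Y : Finset (Fin m → ℕ) :=
    Fintype.piFinset fun l => if l = i₀ then {0} else Finset.range (J + 1) with hY
  have hY0 : ∀ y ∈ Y, y i₀ = 0 := by
    intro y hy
    have := Fintype.mem_piFinset.1 hy i₀
    simpa using this
  have hYJ : ∀ y ∈ Y, ∀ l, y l ≤ J := by
    intro y hy l
    have := Fintype.mem_piFinset.1 hy l
    by_cases hl : l = i₀
    · subst hl; rw [hY0 y hy]; omega
    · simp [hl] at this; omega
  have hyn : ∀ y ∈ Y, ∀ l, y l ≤ n l := by
    intro y hy l
    have e1 : (y l : ℝ) ≤ J := by exact_mod_cast hYJ y hy l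
    have e2 : (y l : ℝ) ≤ n l := by linarith [hn2 l, hNx l]
    exact_mod_cast e2
  set φ : (Fin m → ℕ) → Fin m → ℕ := fun y l =>
    if l = i₀ then N - ∑ l' ∈ Finset.univ.erase i₀, (n l' - y l') else n l - y l with hφ
  have hφne : ∀ y l, l ≠ i₀ → φ y l = n l - y l := fun y l hl => by simp [hφ, hl]
  have hup : ∀ y ∈ Y, ∀ l, ((n l - y l : ℕ) : ℝ) ≤ N * x l := by
    intro y hy l
    rw [Nat.cast_sub (hyn y hy l)]
    linarith [hn1 l, Nat.cast_nonneg (α := ℝ) (y l)]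
  have hlo : ∀ y ∈ Y, ∀ l, N * x l - 2 * h ≤ ((n l - y l : ℕ) : ℝ) := by
    intro y hy l
    rw [Nat.cast_sub (hyn y hy l)]
    have e1 : (y l : ℝ) ≤ J := by exact_mod_cast hYJ y hy l
    linarith [hn2 l]
  have hxsum : ∑ l ∈ Finset.univ.erase i₀, N * x l = N - N * x i₀ := by
    have := Finset.add_sum_erase Finset.univ (fun l => N * x l) (Finset.mem_univ i₀)
    have hall : ∑ l, N * x l = N := by rw [← Finset.mul_sum, R.sum_x, mul_one]
    linarith
  have hsumle : ∀ y ∈ Y, ((∑ l ∈ Finset.univ.erase i₀, (n l - y l) : ℕ) : ℝ) ≤ N - N * x i₀ := by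
    intro y hy
    rw [Nat.cast_sum, ← hxsum]
    exact Finset.sum_le_sum fun l _ => hup y hy l
  have hsumle' : ∀ y ∈ Y, ∑ l ∈ Finset.univ.erase i₀, (n l - y l) ≤ N := by
    intro y hy
    have e1 := hsumle y hy
    have e2 : ((∑ l ∈ Finset.univ.erase i₀, (n l - y l) : ℕ) : ℝ) ≤ N := by nlinarith [hNx i₀]
    exact_mod_cast e2
  have hφ0 : ∀ y, φ y i₀ = N - ∑ l ∈ Finset.univ.erase i₀, (n l - y l) := fun y => by simp [hφ]
  have hφ0R : ∀ y ∈ Y, (φ y i₀ : ℝ) =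
      N - ((∑ l ∈ Finset.univ.erase i₀, (n l - y l) : ℕ) : ℝ) := by
    intro y hy
    rw [hφ0, Nat.cast_sub (hsumle' y hy)]
  have hφsum : ∀ y ∈ Y, ∑ l, φ y l = N := by
    intro y hy
    rw [← Finset.add_sum_erase _ _ (Finset.mem_univ i₀), hφ0,
      Finset.sum_congr rfl fun l hl => hφne y l (Finset.ne_of_mem_erase hl)]
    have := hsumle' y hy
    omega
  have hφlo : ∀ y ∈ Y, N * x i₀ ≤ φ y i₀ := by
    intro y hy
    rw [hφ0R y hy]
    linarith [hsumle y hy]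
  have hφup : ∀ y ∈ Y, (φ y i₀ : ℝ) ≤ N * x i₀ + 2 * m * h := by
    intro y hy
    have e1 : N - N * x i₀ - m * (2 * h) ≤
        ((∑ l ∈ Finset.univ.erase i₀, (n l - y l) : ℕ) : ℝ) := by
      have e2 : ∑ l ∈ Finset.univ.erase i₀, (N * x l - 2 * h) ≤
          ((∑ l ∈ Finset.univ.erase i₀, (n l - y l) : ℕ) : ℝ) := by
        rw [Nat.cast_sum]
        exact Finset.sum_le_sum fun l _ => hlo y hy l
      rw [Finset.sum_sub_distrib, hxsum, Finset.sum_const, nsmul_eq_mul] at e2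
      have e3 : ((Finset.univ.erase i₀).card : ℝ) ≤ m := by
        have := Finset.card_le_univ (Finset.univ.erase i₀)
        rw [Fintype.card_fin] at this
        exact_mod_cast this
      have e4 := mul_le_mul_of_nonneg_right e3 (by linarith : 0 ≤ 2 * h)
      linarith
    rw [hφ0R y hy]
    linarith
  have hbox : ∀ y ∈ Y, ∀ l, |(φ y l : ℝ) - N * x l| ≤ 2 * m * h ∧ κ / 2 * N ≤ φ y l := by
    intro y hy l
    have e0 : 2 * h ≤ 2 * m * h := by nlinarith
    by_cases hl : l = i₀
    · rw [hl, abs_le]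
      have e1 := hφlo y hy
      have e2 := hφup y hy
      exact ⟨⟨by linarith, by linarith⟩, by nlinarith [hNx i₀]⟩
    · rw [hφne y l hl, abs_le]
      have e1 := hlo y hy l
      have e2 := hup y hy l
      exact ⟨⟨by linarith, by linarith⟩, by nlinarith [hNx l]⟩
  refine ⟨Y.image φ, ?_, ?_, ?_⟩
  · intro k hk
    obtain ⟨y, hy, rfl⟩ := Finset.mem_image.1 hk
    refine mem_occupations.2 ⟨hφsum y hy, fun l => ?_, ?_⟩
    · have e1 : (0 : ℝ) < φ y l := lt_of_lt_of_le (by positivity) (hbox y hy l).2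
      have e2 : 0 < φ y l := by exact_mod_cast e1
      omega
    · have e1 : ∑ l, (ε l - ε i₀) * (φ y l - N * x l) ≤ 0 := by
        refine Finset.sum_nonpos fun l _ => ?_
        by_cases hl : l = i₀
        · simp [hl]
        · rw [hφne y l hl]
          refine mul_nonpos_of_nonneg_of_nonpos (sub_nonneg.2 (hε.monotone ?_))
            (sub_nonpos.2 (hup y hy l))
          exact Fin.mk_le_of_le_val (Nat.zero_le _)
      have e2 : ∑ l, (φ y l : ℝ) = N := by exact_mod_cast hφsum y hy
      have e3 : ∑ l, (ε l - ε i₀) * (φ y l - N * x l) =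
          ∑ l, ε l * (φ y l : ℝ) - N * ∑ l, ε l * x l -
            ε i₀ * (∑ l, (φ y l : ℝ) - N * ∑ l, x l) := by
        simp only [Finset.mul_sum, ← Finset.sum_sub_distrib]
        exact Finset.sum_congr rfl fun l _ => by ring
      rw [e2, R.sum_x] at e3
      have e4 := mul_le_mul_of_nonneg_left R.energy hN.le
      linarith
  · have hinj : Set.InjOn φ Y := by
      intro y hy y' hy' hyy
      ext l
      by_cases hl : l = i₀
      · rw [hl, hY0 y hy, hY0 y' hy']
      · have e1 := congrFun hyy l
        rw [hφne y l hl, hφne y' l hl] at e1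
        have e2 := hyn y hy l
        have e3 := hyn y' hy' l
        omega
    rw [Finset.card_image_of_injOn hinj, hY, Fintype.card_piFinset,
      ← Finset.mul_prod_erase _ _ (Finset.mem_univ i₀),
      Finset.prod_congr rfl fun l hl => by rw [if_neg (Finset.ne_of_mem_erase hl)]]
    simp only [if_true, Finset.card_singleton, one_mul, Finset.card_range, Finset.prod_const,
      Finset.card_erase_of_mem (Finset.mem_univ i₀), Finset.card_univ, Fintype.card_fin]
    push_cast
    gcongr
    exact (Nat.lt_floor_add_one h).le
  · intro k hk l
    obtain ⟨y, hy, rfl⟩ := Finset.mem_image.1 hk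
    exact hbox y hy l

/-- A lower bound for the partition function. -/
lemma le_partitionFunction (R : Regular κ K ε E x d N h lam nu v) (hε : StrictMono ε) {r : ℕ}
    (hr : r ≤ 1) :
    tiltConst ε E d N lam nu * (h ^ (m - 1) * (1 / (8 * N)) ^ m *
      Real.exp (-(2 * m * K * ∑ l, |ε l| +
        m * (4 / κ ^ 2 * (8 * m ^ 2 + 2 * (N / h * v ^ 2)))))) ≤
      partitionFunction r ε E d N := by
  obtain ⟨S, hS, hcard, hbox⟩ := R.exists_box hε hr
  have hh : 0 < h := by linarith [R.one_le_h]
  have hN := R.pos_N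
  have hκ := R.pos_κ
  have hT := R.tiltConst_pos
  have hsum : ∑ k ∈ S, Real.exp (entropy d k) ≤ partitionFunction r ε E d N :=
    Finset.sum_le_sum_of_subset_of_nonneg hS fun k _ _ => (Real.exp_pos _).le
  refine le_trans ?_ hsum
  set L := ∑ l, |ε l| with hL
  set B := 4 / κ ^ 2 * (8 * m ^ 2 + 2 * (N / h * v ^ 2)) with hB
  have hterm : ∀ k ∈ S, tiltConst ε E d N lam nu * ((1 / (8 * N)) ^ m *
      Real.exp (-(2 * m * K * L + m * B))) ≤ Real.exp (entropy d k) := by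
    intro k hk
    obtain ⟨hkN, -, -⟩ := mem_occupations.1 (hS hk)
    rw [exp_entropy_eq_tilt E R.d_pos R.ratio_lt_one hkN, ← tiltConst]
    refine mul_le_mul_of_nonneg_left ?_ hT.le
    have h1 : Real.exp (-(2 * m * K * L)) ≤
        Real.exp (lam * (∑ l, ε l * (k l : ℝ) - E * N)) := by
      rw [Real.exp_le_exp]
      have e1 : lam * (∑ l, ε l * (k l : ℝ) - E * N) = lam * ∑ l, ε l * (k l - N * x l) := by
        have : ∑ l, ε l * (k l - N * x l) = ∑ l, ε l * (k l : ℝ) - N * ∑ l, ε l * x l := by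
          rw [Finset.mul_sum, ← Finset.sum_sub_distrib]
          exact Finset.sum_congr rfl fun l _ => by ring
        rw [this]
        linear_combination (-(N : ℝ)) * R.slack
      have e2 : |∑ l, ε l * (k l - N * x l)| ≤ L * (2 * m * h) := by
        refine (Finset.abs_sum_le_sum_abs _ _).trans ?_
        rw [hL, Finset.sum_mul]
        refine Finset.sum_le_sum fun l _ => ?_
        rw [abs_mul]
        exact mul_le_mul_of_nonneg_left (hbox k hk l).1 (abs_nonneg _)
      have hL0 : 0 ≤ L := Finset.sum_nonneg fun _ _ => abs_nonneg _
      have e3 : lam * (L * (2 * m * h)) ≤ 2 * m * K * L := by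
        calc lam * (L * (2 * m * h)) = 2 * m * (lam * h) * L := by ring
          _ ≤ 2 * m * K * L := by gcongr; exact R.lam_mul_h
      have e4 := mul_le_mul_of_nonneg_left (neg_le_of_abs_le e2) R.lam_nonneg
      rw [e1]
      linarith
    have h2 : (1 / (8 * N)) ^ m * Real.exp (-(m * B)) ≤
        ∏ l, negBin (d l) (levelRatio ε lam nu l) (k l) := by
      have : ∏ _l : Fin m, (1 / (8 * (N : ℝ)) * Real.exp (-B)) =
          (1 / (8 * N)) ^ m * Real.exp (-(m * B)) := by
        rw [Finset.prod_const, Finset.card_univ, Fintype.card_fin, mul_pow, ← Real.exp_nat_mul]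
        congr 2
        ring
      rw [← this]
      refine Finset.prod_le_prod (fun l _ => by positivity) fun l _ => ?_
      obtain ⟨hb1, hb2⟩ := hbox k hk l
      have hkpos : (0 : ℝ) < k l := lt_of_lt_of_le (by positivity) hb2
      have hkle : (k l : ℝ) ≤ N := by
        rw [← hkN]
        exact_mod_cast Finset.single_le_sum (fun _ _ => Nat.zero_le _) (Finset.mem_univ l)
      have hμ := R.mean_pos l
      refine le_trans ?_ (le_negBin (R.d_pos l) (by exact_mod_cast hkpos)
        (levelRatio_pos ε lam nu l) (R.ratio_lt_one l) (R.mean_eq l))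
      have hdev : (k l - levelMean ε d lam nu l) ^ 2 ≤ 8 * m ^ 2 * (h * N) + 2 * (N * v) ^ 2 := by
        have e1 : |k l - levelMean ε d lam nu l| ≤ 2 * m * h + N * v := by
          have := abs_sub_le (k l : ℝ) (N * x l) (levelMean ε d lam nu l)
          rw [abs_sub_comm (N * x l)] at this
          linarith [R.mean l]
        have e2 : (k l - levelMean ε d lam nu l) ^ 2 ≤ (2 * m * h + N * v) ^ 2 := by
          rw [← sq_abs]
          gcongr
        have e3 : (h : ℝ) ^ 2 ≤ h * N := by nlinarith [R.h_le_N]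
        nlinarith [sq_nonneg (2 * m * h - N * v), mul_le_mul_of_nonneg_left e3
          (by positivity : (0 : ℝ) ≤ 8 * m ^ 2)]
      have hexp : d l / (k l + d l) * (k l - levelMean ε d lam nu l) ^ 2 / levelMean ε d lam nu l
          ≤ B := by
        calc _ ≤ 2 / κ / h * (8 * m ^ 2 * (h * N) + 2 * (N * v) ^ 2) / (κ / 2 * N) := by
              exact div_le_div₀ (by positivity)
                (mul_le_mul (R.div_add_le l hb2) hdev (sq_nonneg _) (by positivity))
                (by positivity) (R.le_mean l)
          _ = B := by rw [hB]; field_simp; ring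
      gcongr
    calc _ = Real.exp (-(2 * m * K * L)) * ((1 / (8 * N)) ^ m * Real.exp (-(m * B))) := by
          rw [neg_add, Real.exp_add]; ring
      _ ≤ _ := by gcongr
  calc _ = h ^ (m - 1) * (tiltConst ε E d N lam nu * ((1 / (8 * N)) ^ m *
      Real.exp (-(2 * m * K * L + m * B)))) := by ring
    _ ≤ S.card * (tiltConst ε E d N lam nu * ((1 / (8 * N)) ^ m *
      Real.exp (-(2 * m * K * L + m * B)))) := by gcongr
    _ ≤ _ := by
      rw [← nsmul_eq_mul]
      exact Finset.card_nsmul_le_sum _ _ _ hterm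

end Regular

/-- The probability that some coordinate of `X_N` differs from that of `x` by more than `t`. -/
noncomputable def tailProb {m : ℕ} (r : ℕ) (ε : Fin m → ℝ) (E : ℝ) (d : Fin m → ℕ) (N : ℕ)
    (x : Fin m → ℝ) (t : ℝ) : ℝ :=
  open Classical in
  ∑ k ∈ (occupations r ε E N).filter (fun k => ∃ i, t < |(k i : ℝ) / N - x i|),
    Real.exp (entropy d k) / partitionFunction r ε E d N

namespace Regular

variable {m : ℕ} {κ K : ℝ} {ε : Fin m → ℝ} {E : ℝ} {x : Fin m → ℝ} {d : Fin m → ℕ}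
    {N : ℕ} {h lam nu v : ℝ}

lemma partitionFunction_pos (R : Regular κ K ε E x d N h lam nu v) (hε : StrictMono ε) {r : ℕ}
    (hr : r ≤ 1) : 0 < partitionFunction r ε E d N := by
  have := R.tiltConst_pos
  have := R.one_le_h
  have := R.pos_N
  exact lt_of_lt_of_le (by positivity) (R.le_partitionFunction hε hr)

/-- Deviations have probability at most `C s^m e^{C₂ s v² - c s t²}` with `s = N / h`. -/
lemma tailProb_le (R : Regular κ K ε E x d N h lam nu v) (hε : StrictMono ε) {r : ℕ}
    (hr : r ≤ 1) {t : ℝ} (ht : 2 * v ≤ t) (ht0 : 0 ≤ t) (ht1 : t ≤ 1) :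
    tailProb r ε E d N x t ≤
      (m * (4 / κ) * 8 ^ m * Real.exp (2 * m * K * ∑ l, |ε l| + 32 * m ^ 3 / κ ^ 2)) *
        ((N / h) ^ m * Real.exp (8 * m / κ ^ 2 * (N / h * v ^ 2) - N / h * t ^ 2 / (544 * K))) := by
  classical
  have hN := R.pos_N
  have hh : 0 < h := by linarith [R.one_le_h]
  have hκ := R.pos_κ
  have hT := R.tiltConst_pos
  have hZ := R.partitionFunction_pos hε hr
  set Ω := occupations r ε E N with hΩ
  set w : (Fin m → ℕ) → ℝ := fun k => Real.exp (entropy d k) with hw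
  have hw0 : ∀ k, 0 ≤ w k := fun k => (Real.exp_pos _).le
  set D := tiltConst ε E d N lam nu * (2 / κ / h * Real.exp (-(N / h * t ^ 2 / (544 * K)))) with hD
  have hD0 : 0 ≤ D := by positivity
  have hside : ∀ i : Fin m, ∀ σ : ℝ, |σ| = 1 →
      ∑ k ∈ Ω.filter (fun k => t < σ * ((k i : ℝ) / N - x i)), w k ≤ D := by
    intro i σ hσ
    have hdev : ∀ k ∈ Ω.filter (fun k => t < σ * ((k i : ℝ) / N - x i)),
        N * t < σ * (k i - N * x i) := by
      intro k hk
      have h1 := mul_lt_mul_of_pos_left (Finset.mem_filter.1 hk).2 hN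
      refine h1.trans_le (le_of_eq ?_)
      field_simp
    by_cases hj : ∃ j, i ≠ j
    · obtain ⟨j, hij⟩ := hj
      exact R.sum_one_sided_le ht ht0 ht1 hσ hij (Finset.filter_subset _ _)
        fun k hk => (hdev k hk).le
    · -- With a single level there are no deviations at all.
      push Not at hj
      rw [Finset.sum_eq_zero]
      · exact hD0
      intro k hk
      exfalso
      have huniv : (Finset.univ : Finset (Fin m)) = {i} := by
        ext j; simp [hj j]
      have h1 := R.sum_x
      have h2 := (mem_occupations.1 (Finset.filter_subset _ _ hk)).1
      rw [huniv, Finset.sum_singleton] at h1 h2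
      have h3 := hdev k hk
      rw [h1, h2] at h3
      simp only [mul_one, sub_self, mul_zero] at h3
      nlinarith
  have hnum : ∑ k ∈ Ω.filter (fun k => ∃ i, t < |(k i : ℝ) / N - x i|), w k ≤ m * (2 * D) := by
    calc _ ≤ ∑ k ∈ Ω, ∑ i, ((if t < 1 * ((k i : ℝ) / N - x i) then w k else 0) +
            (if t < -1 * ((k i : ℝ) / N - x i) then w k else 0)) := by
          rw [Finset.sum_filter]
          refine Finset.sum_le_sum fun k _ => ?_
          have hterm : ∀ i : Fin m, 0 ≤ (if t < 1 * ((k i : ℝ) / N - x i) then w k else 0) +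
            (if t < -1 * ((k i : ℝ) / N - x i) then w k else 0) := fun i =>
              add_nonneg (by split_ifs <;> simp [hw0]) (by split_ifs <;> simp [hw0])
          split_ifs with hi
          · obtain ⟨i, hi⟩ := hi
            refine le_trans ?_ (Finset.single_le_sum (fun i _ => hterm i) (Finset.mem_univ i))
            rcases lt_abs.1 hi with hi | hi
            · rw [if_pos (by linarith)]
              exact le_add_of_nonneg_right (by split_ifs <;> simp [hw0])
            · rw [if_pos (by linarith : t < -1 * ((k i : ℝ) / N - x i))]
              exact le_add_of_nonneg_left (by split_ifs <;> simp [hw0])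
          · exact Finset.sum_nonneg fun i _ => hterm i
      _ = ∑ i : Fin m, (∑ k ∈ Ω.filter (fun k => t < 1 * ((k i : ℝ) / N - x i)), w k +
            ∑ k ∈ Ω.filter (fun k => t < -1 * ((k i : ℝ) / N - x i)), w k) := by
          rw [Finset.sum_comm]
          refine Finset.sum_congr rfl fun i _ => ?_
          rw [Finset.sum_add_distrib, Finset.sum_filter, Finset.sum_filter]
      _ ≤ ∑ _i : Fin m, (D + D) := Finset.sum_le_sum fun i _ =>
          add_le_add (hside i 1 (by simp)) (hside i (-1) (by simp))
      _ = m * (2 * D) := by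
          rw [Finset.sum_const, Finset.card_univ, Fintype.card_fin, nsmul_eq_mul]; ring
  rw [tailProb, ← Finset.sum_div, div_le_iff₀ hZ]
  refine hnum.trans ?_
  refine le_trans (le_of_eq ?_) (mul_le_mul_of_nonneg_left (R.le_partitionFunction hε hr)
    (by positivity))
  have hpow : h ^ m = h ^ (m - 1) * h := (pow_sub_one_mul R.pos_m.ne' h).symm
  set L := ∑ l, |ε l|
  have e1 : Real.exp (2 * m * K * L + 32 * m ^ 3 / κ ^ 2) *
      Real.exp (8 * m / κ ^ 2 * (N / h * v ^ 2) - N / h * t ^ 2 / (544 * K)) *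
      Real.exp (-(2 * m * K * L + m * (4 / κ ^ 2 * (8 * m ^ 2 + 2 * (N / h * v ^ 2))))) =
      Real.exp (-(N / h * t ^ 2 / (544 * K))) := by
    rw [← Real.exp_add, ← Real.exp_add]
    congr 1
    ring
  rw [hD, ← e1, div_pow, div_pow, mul_pow, hpow]
  field_simp
  ring

end Regular

/-! ### Concentration as the number of particles grows -/

/-- The asymptotic form of the deviation bound: up to a factor, `u + v` is the size of the
deviations, where `u = s^{-(1/2 - 3δ)}` and `s = N / h`. -/
lemma exists_tailProb_le {m : ℕ} {κ K : ℝ} {ε : Fin m → ℝ} {E : ℝ} {x : Fin m → ℝ}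
    {d : ℕ → Fin m → ℕ} {h lam nu v s : ℕ → ℝ} (hε : StrictMono ε) {r : ℕ} (hr : r ≤ 1)
    (R : ∀ᶠ N in atTop, Regular κ K ε E x (d N) N (h N) (lam N) (nu N) (v N))
    (hs : ∀ᶠ N : ℕ in atTop, s N = N / h N) (hlim : Tendsto s atTop atTop)
    (hv0 : ∀ᶠ N in atTop, 0 ≤ v N) (hv : Tendsto v atTop (𝓝 0))
    {δ : ℝ} (hδ0 : 0 < δ) (hδ : δ < 1 / 6) :
    ∃ A : ℝ, 0 < A ∧ ∀ᶠ N in atTop,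
      tailProb r ε E (d N) N x (A * (1 / s N ^ (1 / 2 - 3 * δ) + v N)) ≤
        1 / s N ^ (1 / 2 - 3 * δ) := by
  obtain ⟨N₀, R₀⟩ := R.exists
  have hκ := R₀.pos_κ
  have hK : 0 < K := by linarith [R₀.one_le_K]
  set C := m * (4 / κ) * 8 ^ m * Real.exp (2 * m * K * ∑ l, |ε l| + 32 * m ^ 3 / κ ^ 2) with hC
  set c₂ : ℝ := 8 * m / κ ^ 2 with hc₂
  have hc₂0 : 0 ≤ c₂ := by positivity
  have hC0 : 0 ≤ C := by positivity
  -- `A` is chosen so that `A² / (544 K)` dominates both `1` and `c₂`.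
  set A : ℝ := 544 * K * (1 + c₂) + 2 with hA
  have hA2 : 2 ≤ A := by rw [hA]; nlinarith [mul_pos hK (by linarith : 0 < 1 + c₂)]
  have hA0 : 0 < A := by linarith
  have hAK : 1 + c₂ ≤ A ^ 2 / (544 * K) := by
    rw [le_div_iff₀ (by positivity)]
    nlinarith
  set γ : ℝ := 1 / 2 - 3 * δ with hγ
  have hγ0 : 0 < γ := by rw [hγ]; linarith
  have hu : Tendsto (fun N => 1 / s N ^ γ) atTop (𝓝 0) := by
    simp only [one_div]
    exact ((tendsto_rpow_atTop hγ0).comp hlim).inv_tendsto_atTop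
  have ht : Tendsto (fun N => A * (1 / s N ^ γ + v N)) atTop (𝓝 0) := by
    simpa using (hu.add hv).const_mul A
  have ht1 : ∀ᶠ N in atTop, A * (1 / s N ^ γ + v N) ≤ 1 :=
    (ht.eventually_lt_const one_pos).mono fun _ h => h.le
  have hdecay : Tendsto (fun N => C * (s N ^ ((m : ℝ) + γ) * Real.exp (-(s N ^ (6 * δ)))))
      atTop (𝓝 0) := by
    have h1 := (tendsto_rpow_mul_exp_neg_mul_atTop_nhds_zero (((m : ℝ) + γ) / (6 * δ)) 1
      one_pos).comp ((tendsto_rpow_atTop (by positivity : 0 < 6 * δ)).comp hlim)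
    have h2 := h1.const_mul C
    rw [mul_zero] at h2
    refine h2.congr' ?_
    filter_upwards [hlim.eventually_ge_atTop 0] with N hN
    simp only [Function.comp]
    rw [← Real.rpow_mul hN, mul_div_cancel₀ _ (by positivity), neg_one_mul]
  refine ⟨A, hA0, ?_⟩
  filter_upwards [R, hs, hlim.eventually_gt_atTop 0, hv0, ht1,
    hdecay.eventually_le_const one_pos] with N RN hsN hspos hv0N ht1N hdN
  have hupos : 0 < 1 / s N ^ γ := by positivity
  set u := 1 / s N ^ γ with hudef
  refine (RN.tailProb_le hε hr (by nlinarith) (by positivity) ht1N).trans ?_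
  rw [← hsN]
  have hsu : s N * u ^ 2 = s N ^ (6 * δ) := by
    have h1 : u ^ 2 = s N ^ (-(2 * γ)) := by
      rw [hudef, one_div, ← Real.rpow_neg hspos.le, ← Real.rpow_natCast, ← Real.rpow_mul hspos.le]
      congr 1
      push_cast
      ring
    rw [h1]
    nth_rewrite 1 [← Real.rpow_one (s N)]
    rw [← Real.rpow_add hspos]
    congr 1
    rw [hγ]
    ring
  have hexp : c₂ * (s N * v N ^ 2) - s N * (A * (u + v N)) ^ 2 / (544 * K) ≤ -(s N ^ (6 * δ)) := by
    have h1 : s N * (A * (u + v N)) ^ 2 / (544 * K) =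
        A ^ 2 / (544 * K) * (s N * (u + v N) ^ 2) := by ring
    have h2 : s N * u ^ 2 + s N * v N ^ 2 ≤ s N * (u + v N) ^ 2 := by
      nlinarith [mul_nonneg hspos.le (mul_nonneg hupos.le hv0N)]
    have h3 : (1 + c₂) * (s N * (u + v N) ^ 2) ≤ A ^ 2 / (544 * K) * (s N * (u + v N) ^ 2) := by
      gcongr
    have h4 : 0 ≤ s N * v N ^ 2 := by positivity
    have h5 : 0 ≤ s N * u ^ 2 := by positivity
    have h6 : (1 + c₂) * (s N * u ^ 2 + s N * v N ^ 2) ≤ (1 + c₂) * (s N * (u + v N) ^ 2) := by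
      gcongr
    rw [h1, ← hsu]
    nlinarith
  calc C * (s N ^ m * Real.exp (c₂ * (s N * v N ^ 2) - s N * (A * (u + v N)) ^ 2 / (544 * K)))
      ≤ C * (s N ^ m * Real.exp (-(s N ^ (6 * δ)))) := by gcongr
    _ = C * (s N ^ ((m : ℝ) + γ) * Real.exp (-(s N ^ (6 * δ)))) * u := by
        rw [Real.rpow_add hspos, Real.rpow_natCast, hudef]
        field_simp
    _ ≤ 1 * u := by gcongr
    _ = u := one_mul u

/-! ### Weak convergence and moment generating functions -/

lemma integral_law {m : ℕ} (r : ℕ) (ε : Fin m → ℝ) (E : ℝ) (d : Fin m → ℕ) (N : ℕ)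
    (f : (Fin m → ℝ) → ℝ) :
    ∫ y, f y ∂(law r ε E d N) = ∑ k ∈ occupations r ε E N,
      Real.exp (entropy d k) / partitionFunction r ε E d N * f (fun i => (k i : ℝ) / N) := by
  rw [law, integral_finsetSum_measure]
  · refine Finset.sum_congr rfl fun k _ => ?_
    have hZ : 0 ≤ partitionFunction r ε E d N := Finset.sum_nonneg fun _ _ => (Real.exp_pos _).le
    rw [integral_smul_measure, integral_dirac, ENNReal.toReal_ofReal (by positivity), smul_eq_mul]
  · intro k _
    refine Integrable.smul_measure ?_ ENNReal.ofReal_ne_top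
    exact integrable_dirac (by simp)

lemma sum_prob_eq_one {m r N : ℕ} {ε : Fin m → ℝ} {E : ℝ} {d : Fin m → ℕ}
    (hZ : 0 < partitionFunction r ε E d N) :
    ∑ k ∈ occupations r ε E N, Real.exp (entropy d k) / partitionFunction r ε E d N = 1 := by
  rw [← Finset.sum_div]
  exact div_self hZ.ne'

lemma isProbabilityMeasure_law {m r N : ℕ} {ε : Fin m → ℝ} {E : ℝ} {d : Fin m → ℕ}
    (hZ : 0 < partitionFunction r ε E d N) : IsProbabilityMeasure (law r ε E d N) := by
  constructor
  simp only [law, Measure.coe_finsetSum, Finset.sum_apply, Measure.smul_apply, measure_univ,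
    smul_eq_mul, mul_one]
  rw [← ENNReal.ofReal_sum_of_nonneg fun k _ => by positivity, sum_prob_eq_one hZ,
    ENNReal.ofReal_one]

/-- Splitting the expectation of `f` according to whether `X_N` is within `t` of `x`. -/
lemma abs_integral_law_sub_le {m r N : ℕ} {ε : Fin m → ℝ} {E : ℝ} {d : Fin m → ℕ}
    (hZ : 0 < partitionFunction r ε E d N) (f : (Fin m → ℝ) → ℝ) {x : Fin m → ℝ} {t a b : ℝ}
    (ha0 : 0 ≤ a) (ha : ∀ k ∈ occupations r ε E N, (∀ i, |(k i : ℝ) / N - x i| ≤ t) →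
      |f (fun i => (k i : ℝ) / N) - f x| ≤ a)
    (hb : ∀ k ∈ occupations r ε E N, |f (fun i => (k i : ℝ) / N) - f x| ≤ b) :
    |∫ y, f y ∂(law r ε E d N) - f x| ≤ a + b * tailProb r ε E d N x t := by
  classical
  set p : (Fin m → ℕ) → ℝ :=
    fun k => Real.exp (entropy d k) / partitionFunction r ε E d N with hp
  have hp0 : ∀ k, 0 ≤ p k := fun k => by positivity
  have hp1 : ∑ k ∈ occupations r ε E N, p k = 1 := sum_prob_eq_one hZ
  have h1 : ∫ y, f y ∂(law r ε E d N) - f x =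
      ∑ k ∈ occupations r ε E N, p k * (f (fun i => (k i : ℝ) / N) - f x) := by
    rw [integral_law]
    simp only [mul_sub, Finset.sum_sub_distrib]
    rw [← Finset.sum_mul, hp1, one_mul]
  have h2 : a + b * tailProb r ε E d N x t =
      ∑ k ∈ occupations r ε E N,
        (p k * a + if ∃ i, t < |(k i : ℝ) / N - x i| then p k * b else 0) := by
    rw [Finset.sum_add_distrib, ← Finset.sum_mul, hp1, one_mul, tailProb, ← Finset.sum_filter,
      ← Finset.sum_mul, mul_comm b]
  rw [h1, h2]
  refine (Finset.abs_sum_le_sum_abs _ _).trans (Finset.sum_le_sum fun k hk => ?_)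
  rw [abs_mul, abs_of_nonneg (hp0 k)]
  split_ifs with hi
  · exact (mul_le_mul_of_nonneg_left (hb k hk) (hp0 k)).trans
      (le_add_of_nonneg_left (mul_nonneg (hp0 k) ha0))
  · push Not at hi
    rw [add_zero]
    exact mul_le_mul_of_nonneg_left (ha k hk hi) (hp0 k)

lemma exp_sub_exp_le {a b L : ℝ} (ha : a ≤ L) : Real.exp a - Real.exp b ≤ Real.exp L * |a - b| := by
  have h1 := Real.add_one_le_exp (b - a)
  have h2 : Real.exp b = Real.exp a * Real.exp (b - a) := by rw [← Real.exp_add]; congr 1; ring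
  have h3 : Real.exp a * (1 - Real.exp (b - a)) ≤ Real.exp a * |a - b| := by
    gcongr
    linarith [le_abs_self (a - b)]
  have h4 : Real.exp a * |a - b| ≤ Real.exp L * |a - b| := by gcongr
  rw [h2]
  linarith

lemma abs_exp_sub_exp_le {a b L : ℝ} (ha : a ≤ L) (hb : b ≤ L) :
    |Real.exp a - Real.exp b| ≤ Real.exp L * |a - b| := by
  rw [abs_sub_le_iff]
  refine ⟨exp_sub_exp_le ha, ?_⟩
  rw [abs_sub_comm]
  exact exp_sub_exp_le hb

lemma abs_vecMgf_sub_le {m r N : ℕ} {ε : Fin m → ℝ} {E : ℝ} {d : Fin m → ℕ}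
    (hZ : 0 < partitionFunction r ε E d N) (hN : 0 < N) {x : Fin m → ℝ}
    (hx0 : ∀ i, 0 ≤ x i) (hx1 : ∀ i, x i ≤ 1) (ξ : Fin m → ℝ) {t : ℝ} (ht : 0 ≤ t) :
    |vecMgf (law r ε E d N) ξ - Real.exp (∑ i, ξ i * x i)| ≤
      Real.exp (∑ i, |ξ i|) * (∑ i, |ξ i|) * (t + tailProb r ε E d N x t) := by
  set L := ∑ i, |ξ i| with hL
  have hL0 : 0 ≤ L := Finset.sum_nonneg fun _ _ => abs_nonneg _
  have hN' : (0 : ℝ) < N := by exact_mod_cast hN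
  have hle : ∀ y : Fin m → ℝ, (∀ i, 0 ≤ y i) → (∀ i, y i ≤ 1) → ∑ i, ξ i * y i ≤ L := by
    intro y h0 h1
    refine Finset.sum_le_sum fun i _ => ?_
    calc ξ i * y i ≤ |ξ i| * y i := mul_le_mul_of_nonneg_right (le_abs_self _) (h0 i)
      _ ≤ |ξ i| := mul_le_of_le_one_right (abs_nonneg _) (h1 i)
  have hdiff : ∀ (y : Fin m → ℝ) (τ : ℝ), (∀ i, 0 ≤ y i) → (∀ i, y i ≤ 1) →
      (∀ i, |y i - x i| ≤ τ) →
      |Real.exp (∑ i, ξ i * y i) - Real.exp (∑ i, ξ i * x i)| ≤ Real.exp L * L * τ := by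
    intro y τ h0 h1 hτ
    refine (abs_exp_sub_exp_le (hle y h0 h1) (hle x hx0 hx1)).trans ?_
    rw [mul_assoc]
    refine mul_le_mul_of_nonneg_left ?_ (Real.exp_pos _).le
    rw [← Finset.sum_sub_distrib, hL, Finset.sum_mul]
    refine (Finset.abs_sum_le_sum_abs _ _).trans (Finset.sum_le_sum fun i _ => ?_)
    rw [← mul_sub, abs_mul]
    exact mul_le_mul_of_nonneg_left (hτ i) (abs_nonneg _)
  have hk1 : ∀ k ∈ occupations r ε E N, ∀ i, (k i : ℝ) / N ≤ 1 := by
    intro k hk i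
    rw [div_le_one hN', ← (mem_occupations.1 hk).1]
    exact_mod_cast Finset.single_le_sum (fun _ _ => Nat.zero_le _) (Finset.mem_univ i)
  have h := abs_integral_law_sub_le hZ (fun y => Real.exp (∑ i, ξ i * y i)) (x := x) (t := t)
    (a := Real.exp L * L * t) (b := Real.exp L * L * 1) (by positivity)
    (fun k hk hi => hdiff _ t (fun i => by positivity) (hk1 k hk) hi)
    (fun k hk => hdiff _ 1 (fun i => by positivity) (hk1 k hk) fun i => by
      have h1 := hk1 k hk i
      have h2 : 0 ≤ (k i : ℝ) / N := by positivity
      exact abs_le.2 ⟨by linarith [hx1 i], by linarith [hx0 i]⟩)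
  refine h.trans (le_of_eq ?_)
  ring

lemma MuchLarger.isBigO {u v : ℕ → ℝ} (h : MuchLarger u v) : v =O[atTop] u := by
  refine IsBigO.of_bound 1 ?_
  filter_upwards [h.eventually_ge_atTop 1] with N hN
  have hv : 0 < |v N| := abs_pos.2 fun hv => by norm_num [hv] at hN
  have h1 : 1 ≤ |u N| / |v N| := by
    rw [← abs_div]
    exact hN.trans (le_abs_self _)
  rw [le_div_iff₀ hv] at h1
  simpa using h1

/-- Concentration within `O(u + v)` gives the weak law and the rates for the moment generating
functions. -/
theorem convergesToConst_and_mgfRate {m : ℕ} {κ K : ℝ} {ε : Fin m → ℝ} {E : ℝ} {x : Fin m → ℝ}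
    {d : ℕ → Fin m → ℕ} {h lam nu v s : ℕ → ℝ} (hε : StrictMono ε) {r : ℕ} (hr : r ≤ 1)
    (R : ∀ᶠ N in atTop, Regular κ K ε E x (d N) N (h N) (lam N) (nu N) (v N))
    (hs : ∀ᶠ N : ℕ in atTop, s N = N / h N) (hlim : Tendsto s atTop atTop)
    (hv0 : ∀ᶠ N in atTop, 0 ≤ v N) (hv : Tendsto v atTop (𝓝 0)) :
    ConvergesToConst (fun N => law r ε E (d N) N) x ∧
      ∀ w : ℕ → ℝ, v =O[atTop] w → ∀ δ ∈ rateConstants m,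
        MgfRate (fun N => law r ε E (d N) N) x (fun N => 1 / s N ^ (1 / 2 - 3 * δ)) w := by
  have hZ : ∀ᶠ N in atTop, 0 < partitionFunction r ε E (d N) N :=
    R.mono fun N RN => RN.partitionFunction_pos hε hr
  obtain ⟨N₀, R₀⟩ := R.exists
  have hx0 : ∀ i, 0 ≤ x i := fun i => R₀.pos_κ.le.trans (R₀.le_x i)
  refine ⟨⟨hZ.mono fun N hN => isProbabilityMeasure_law hN, ?_⟩, ?_⟩
  · rw [FiniteMeasure.tendsto_iff_forall_integral_tendsto]
    intro f
    change Tendsto (fun N => ∫ y, f y ∂(law r ε E (d N) N)) atTop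
      (𝓝 (∫ y, f y ∂(Measure.dirac x)))
    rw [integral_dirac]
    obtain ⟨A, hA0, hA⟩ := exists_tailProb_le hε hr R hs hlim hv0 hv
      (δ := 1 / 12) (by norm_num) (by norm_num)
    have hu : Tendsto (fun N => 1 / s N ^ ((1 : ℝ) / 2 - 3 * (1 / 12))) atTop (𝓝 0) := by
      simp only [one_div]
      exact ((tendsto_rpow_atTop (by norm_num)).comp hlim).inv_tendsto_atTop
    have ht : Tendsto (fun N => A * (1 / s N ^ ((1 : ℝ) / 2 - 3 * (1 / 12)) + v N)) atTop
        (𝓝 0) := by simpa using (hu.add hv).const_mul A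
    rw [Metric.tendsto_atTop']
    intro η hη
    obtain ⟨ρ, hρ, hfρ⟩ := Metric.continuous_iff.1 f.continuous x (η / 2) (by linarith)
    have hub : Tendsto (fun N => 2 * ‖f‖ * (1 / s N ^ ((1 : ℝ) / 2 - 3 * (1 / 12)))) atTop
        (𝓝 0) := by simpa using hu.const_mul (2 * ‖f‖)
    have hfin : ∀ᶠ N in atTop, dist (∫ y, f y ∂(law r ε E (d N) N)) (f x) < η := by
      filter_upwards [hZ, hA, ht.eventually_lt_const hρ,
        hub.eventually_lt_const (by linarith : 0 < η / 2)] with N hZN hAN htN hubN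
      rw [Real.dist_eq]
      have hb := abs_integral_law_sub_le hZN f (x := x)
        (t := A * (1 / s N ^ ((1 : ℝ) / 2 - 3 * (1 / 12)) + v N)) (a := η / 2) (b := 2 * ‖f‖)
        (by linarith) (by
          intro k hk hi
          refine (hfρ _ ?_).le
          rw [dist_pi_lt_iff hρ]
          exact fun i => (hi i).trans_lt htN)
        (fun k hk => f.dist_le_two_norm _ _)
      have h2 := mul_le_mul_of_nonneg_left hAN (by positivity : 0 ≤ 2 * ‖f‖)
      linarith
    exact (eventually_atTop.1 hfin).imp fun N hN n hn => hN n (le_of_lt hn)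
  · intro w hw δ hδ ξ
    obtain ⟨hδ0, hδ1⟩ := hδ
    have hδ6 : δ < 1 / 6 := hδ1.trans_le (min_le_right _ _)
    obtain ⟨A, hA0, hA⟩ := exists_tailProb_le hε hr R hs hlim hv0 hv hδ0 hδ6
    set u : ℕ → ℝ := fun N => 1 / s N ^ (1 / 2 - 3 * δ) with hu
    have hbound : (fun N => vecMgf (law r ε E (d N) N) ξ - Real.exp (∑ i, ξ i * x i)) =O[atTop]
        fun N => (A + 1) * u N + A * v N := by
      refine IsBigO.of_bound (Real.exp (∑ i, |ξ i|) * (∑ i, |ξ i|)) ?_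
      filter_upwards [hZ, hA, R, hv0, hlim.eventually_gt_atTop 0] with N hZN hAN RN hvN hsN
      have hu0 : 0 < u N := by simp only [hu]; positivity
      have hN : 0 < N := by exact_mod_cast RN.pos_N
      have hL : 0 ≤ ∑ i, |ξ i| := Finset.sum_nonneg fun _ _ => abs_nonneg _
      rw [Real.norm_eq_abs, Real.norm_of_nonneg (by positivity)]
      refine (abs_vecMgf_sub_le hZN hN hx0 RN.x_le_one ξ
        (t := A * (u N + v N)) (by positivity)).trans ?_
      refine mul_le_mul_of_nonneg_left ?_ (by positivity)
      have hAN' : tailProb r ε E (d N) N x (A * (u N + v N)) ≤ u N := hAN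
      linarith
    refine ⟨fun huw => ?_, fun hwu => ?_⟩
    · refine hbound.trans ((isBigO_refl u _).const_mul_left _ |>.add ?_)
      exact (hw.trans huw.isBigO).const_mul_left _
    · refine hbound.trans ((hwu.isBigO.const_mul_left _).add ?_)
      exact hw.const_mul_left _

/-! ### The multipliers -/

/-- An occupation number `φ` as a function of the exponent `a = λ ε + ν`: strictly decreasing from
`∞` to `0` on its domain `D`, a half-line unbounded above or the whole line, and not positive
outside of `D`. The function `Ψ` is an antiderivative of `-φ`. -/
structure OccupationFunction (φ Ψ : ℝ → ℝ) (D : Set ℝ) : Prop where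
  up : ∀ ⦃a b⦄, a ∈ D → a ≤ b → b ∈ D
  mem_of_pos : ∀ ⦃a⦄, 0 < φ a → a ∈ D
  pos : ∀ ⦃a⦄, a ∈ D → 0 < φ a
  anti : StrictAntiOn φ D
  deriv : ∀ ⦃a⦄, a ∈ D → HasDerivAt Ψ (-φ a) a
  surj : ∀ ⦃y⦄, 0 < y → ∃ a ∈ D, φ a = y
  tendsto : Tendsto φ atTop (𝓝 0)

/-- A minimum over an interval at whose ends the function decreases inwards is a critical point. -/
lemma eq_zero_of_isMinOn_Icc {f : ℝ → ℝ} {f' z lo hi : ℝ} (hlh : lo < hi) (hz : z ∈ Set.Icc lo hi)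
    (hmin : IsMinOn f (Set.Icc lo hi) z) (hd : HasDerivAt f f' z)
    (hlo : z = lo → f' < 0) (hhi : z = hi → 0 < f') : f' = 0 := by
  have hright : z < hi → 0 ≤ f' := by
    intro h
    have hs := (hasDerivWithinAt_iff_tendsto_slope' (Set.notMem_Ioi.2 le_rfl)).1
      (hd.hasDerivWithinAt (s := Set.Ioi z))
    refine ge_of_tendsto hs ?_
    filter_upwards [Ioo_mem_nhdsGT h] with w hw
    rw [slope_def_field]
    exact div_nonneg (sub_nonneg.2 (hmin ⟨hz.1.trans hw.1.le, hw.2.le⟩)) (sub_nonneg.2 hw.1.le)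
  have hleft : lo < z → f' ≤ 0 := by
    intro h
    have hs := (hasDerivWithinAt_iff_tendsto_slope' (Set.notMem_Iio.2 le_rfl)).1
      (hd.hasDerivWithinAt (s := Set.Iio z))
    refine le_of_tendsto hs ?_
    filter_upwards [Ioo_mem_nhdsLT h] with w hw
    rw [slope_def_field]
    exact div_nonpos_of_nonneg_of_nonpos (sub_nonneg.2 (hmin ⟨hw.1.le, hw.2.le.trans hz.2⟩))
      (sub_nonpos.2 hw.2.le)
  rcases eq_or_lt_of_le hz.1 with h | h
  · have h1 := hlo h.symm
    have h2 := hright (h ▸ hlh)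
    linarith
  · rcases eq_or_lt_of_le hz.2 with h' | h'
    · have h1 := hhi h'
      have h2 := hleft h
      linarith
    · exact le_antisymm (hleft h) (hright h')

namespace OccupationFunction

variable {φ Ψ : ℝ → ℝ} {D : Set ℝ}

lemma pairing_nonpos (O : OccupationFunction φ Ψ D) {a b : ℝ} (ha : a ∈ D) (hb : b ∈ D) :
    (φ a - φ b) * (a - b) ≤ 0 := by
  rcases le_total a b with h | h
  · exact mul_nonpos_of_nonneg_of_nonpos (sub_nonneg.2 (O.anti.antitoneOn ha hb h))
      (sub_nonpos.2 h)
  · exact mul_nonpos_of_nonpos_of_nonneg (sub_nonpos.2 (O.anti.antitoneOn hb ha h))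
      (sub_nonneg.2 h)

lemma eq_of_pairing_eq_zero (O : OccupationFunction φ Ψ D) {a b : ℝ} (ha : a ∈ D) (hb : b ∈ D)
    (h : (φ a - φ b) * (a - b) = 0) : a = b := by
  rcases mul_eq_zero.1 h with h | h
  · exact O.anti.injOn ha hb (sub_eq_zero.1 h)
  · exact sub_eq_zero.1 h

lemma mem_of_solves (O : OccupationFunction φ Ψ D) {m : ℕ} {g ε : Fin m → ℝ} (hg : ∀ i, 0 < g i)
    {E : ℝ} {p : ℝ × ℝ} (hp : SolvesConstraints ε E fun i => g i * φ (p.1 * ε i + p.2))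
    (i : Fin m) : p.1 * ε i + p.2 ∈ D :=
  O.mem_of_pos (pos_of_mul_pos_right (hp.1 i) (hg i).le)

/-- Uniqueness of the multipliers, by strict monotonicity of `-φ`. -/
lemma solves_unique (O : OccupationFunction φ Ψ D) {m : ℕ} {g ε : Fin m → ℝ} (hg : ∀ i, 0 < g i)
    (hε : StrictMono ε) (hm : 1 < m) {E : ℝ} {p p' : ℝ × ℝ}
    (hp : SolvesConstraints ε E fun i => g i * φ (p.1 * ε i + p.2))
    (hp' : SolvesConstraints ε E fun i => g i * φ (p'.1 * ε i + p'.2)) : p = p' := by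
  set a : Fin m → ℝ := fun i => p.1 * ε i + p.2 with ha
  set b : Fin m → ℝ := fun i => p'.1 * ε i + p'.2 with hb
  have hD := O.mem_of_solves hg hp
  have hD' := O.mem_of_solves hg hp'
  have hnonneg : ∀ i ∈ Finset.univ, 0 ≤ g i * (-((φ (a i) - φ (b i)) * (a i - b i))) := fun i _ =>
    mul_nonneg (hg i).le (neg_nonneg.2 (O.pairing_nonpos (hD i) (hD' i)))
  have hsum : ∑ i, g i * (-((φ (a i) - φ (b i)) * (a i - b i))) = 0 := by
    have h1 : ∑ i, g i * (-((φ (a i) - φ (b i)) * (a i - b i))) =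
        -(p.1 - p'.1) * (∑ i, ε i * (g i * φ (a i)) - ∑ i, ε i * (g i * φ (b i))) -
        (p.2 - p'.2) * (∑ i, g i * φ (a i) - ∑ i, g i * φ (b i)) := by
      simp only [← Finset.sum_sub_distrib, Finset.mul_sum]
      refine Finset.sum_congr rfl fun i _ => ?_
      simp only [ha, hb]
      ring
    rw [h1, hp.2.1, hp'.2.1, hp.2.2, hp'.2.2]
    ring
  have heq : ∀ i, a i = b i := by
    intro i
    have h1 := (Finset.sum_eq_zero_iff_of_nonneg hnonneg).1 hsum i (Finset.mem_univ i)
    rcases mul_eq_zero.1 h1 with h2 | h2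
    · exact absurd h2 (hg i).ne'
    · exact O.eq_of_pairing_eq_zero (hD i) (hD' i) (neg_eq_zero.1 h2)
  have h0 := heq ⟨0, by omega⟩
  have h1 := heq ⟨1, hm⟩
  have hlt : ε ⟨0, by omega⟩ < ε ⟨1, hm⟩ := hε (by simp)
  simp only [ha, hb] at h0 h1
  have hfst : p.1 = p'.1 := by
    have h2 : (p.1 - p'.1) * (ε ⟨1, hm⟩ - ε ⟨0, by omega⟩) = 0 := by linear_combination h1 - h0
    rcases mul_eq_zero.1 h2 with h3 | h3
    · exact sub_eq_zero.1 h3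
    · linarith
  refine Prod.ext hfst ?_
  rw [hfst] at h0
  linarith

/-- Below the mean energy of the levels the multiplier `λ` of the energy is nonnegative: compare
with the solution `g`, for which `λ = 0`. -/
lemma multiplier_nonneg (O : OccupationFunction φ Ψ D) {m : ℕ} {g ε : Fin m → ℝ}
    (hg : ∀ i, 0 < g i) (hg1 : ∑ i, g i = 1) {E : ℝ} (hE : E < ∑ i, g i * ε i) {p : ℝ × ℝ}
    (hp : SolvesConstraints ε E fun i => g i * φ (p.1 * ε i + p.2)) : 0 ≤ p.1 := by
  obtain ⟨b, hb, hφb⟩ := O.surj one_pos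
  have hD := O.mem_of_solves hg hp
  have h1 : ∑ i, g i * ((φ (p.1 * ε i + p.2) - φ b) * (p.1 * ε i + p.2 - b)) ≤ 0 :=
    Finset.sum_nonpos fun i _ =>
      mul_nonpos_of_nonneg_of_nonpos (hg i).le (O.pairing_nonpos (hD i) hb)
  have h2 : ∑ i, g i * ((φ (p.1 * ε i + p.2) - φ b) * (p.1 * ε i + p.2 - b)) =
      p.1 * (∑ i, ε i * (g i * φ (p.1 * ε i + p.2)) - ∑ i, g i * ε i) +
      (p.2 - b) * (∑ i, g i * φ (p.1 * ε i + p.2) - ∑ i, g i) := by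
    simp only [← Finset.sum_sub_distrib, Finset.mul_sum, ← Finset.sum_add_distrib]
    refine Finset.sum_congr rfl fun i _ => ?_
    rw [hφb]
    ring
  rw [h2, hp.2.1, hp.2.2, hg1] at h1
  by_contra! h
  nlinarith [mul_pos_of_neg_of_neg h (sub_neg.2 hE)]

/-- Existence of the multipliers: they minimize the convex function
`∑ g_i Ψ(a + λ Δ_i) + a + λ e`, with `a = λ ε_1 + ν` and energies relative to the ground level, over
a rectangle at whose sides the gradient points outwards. -/
lemma exists_solves (O : OccupationFunction φ Ψ D) {m : ℕ} (hm : 0 < m) {g ε : Fin m → ℝ}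
    (hg : ∀ i, 0 < g i) (hg1 : ∑ i, g i = 1) (hε : StrictMono ε) {E : ℝ}
    (hE0 : ε ⟨0, hm⟩ < E) (hE : E < ∑ i, g i * ε i) :
    ∃ p : ℝ × ℝ, SolvesConstraints ε E fun i => g i * φ (p.1 * ε i + p.2) := by
  set i₀ : Fin m := ⟨0, hm⟩
  set Δ : Fin m → ℝ := fun i => ε i - ε i₀ with hΔ
  have hΔ0 : ∀ i, 0 ≤ Δ i := fun i =>
    sub_nonneg.2 (hε.monotone (Fin.mk_le_of_le_val (Nat.zero_le _)))
  set e := E - ε i₀ with he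
  have he0 : 0 < e := sub_pos.2 hE0
  set T := ∑ i, g i * Δ i with hT
  have hTe : e < T := by
    have : T = ∑ i, g i * ε i - ε i₀ := by
      simp only [hT, hΔ, mul_sub, Finset.sum_sub_distrib, ← Finset.sum_mul, hg1, one_mul]
    linarith
  have hT0 : 0 < T := he0.trans hTe
  obtain ⟨lo, hloD, hlo⟩ := O.surj (show 0 < 2 / g i₀ from div_pos two_pos (hg i₀))
  obtain ⟨y, hy1, hy2⟩ := exists_between ((div_lt_one hT0).2 hTe)
  obtain ⟨hi, hhiD, hhi⟩ := O.surj ((div_pos he0 hT0).trans hy1)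
  have hgi₀ : g i₀ ≤ 1 := by
    rw [← hg1]
    exact Finset.single_le_sum (fun i _ => (hg i).le) (Finset.mem_univ i₀)
  have hlohi : lo < hi := by
    by_contra! h
    have h1 := O.anti.antitoneOn hhiD hloD h
    rw [hlo, hhi] at h1
    have h2 : 2 ≤ 2 / g i₀ := by rw [le_div_iff₀ (hg i₀)]; linarith
    linarith
  have hDlo : ∀ a, lo ≤ a → ∀ t, 0 ≤ t → ∀ i, a + t * Δ i ∈ D := fun a ha t ht i =>
    O.up hloD (by nlinarith [mul_nonneg ht (hΔ0 i)])
  have htop : Tendsto (fun t => ∑ i, g i * Δ i * φ (lo + t * Δ i)) atTop (𝓝 0) := by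
    have : ∀ i ∈ Finset.univ, Tendsto (fun t => g i * Δ i * φ (lo + t * Δ i)) atTop (𝓝 0) := by
      intro i _
      rcases (hΔ0 i).eq_or_lt with h | h
      · simp [← h]
      · have h1 : Tendsto (fun t : ℝ => lo + t * Δ i) atTop atTop :=
          tendsto_atTop_add_const_left _ _ (tendsto_id.atTop_mul_const h)
        simpa using (O.tendsto.comp h1).const_mul (g i * Δ i)
    simpa using tendsto_finsetSum Finset.univ this
  obtain ⟨Λ, hΛ, hΛ0⟩ := ((htop.eventually_lt_const he0).and (eventually_gt_atTop 0)).exists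
  set F : ℝ × ℝ → ℝ := fun z => ∑ i, g i * Ψ (z.1 + z.2 * Δ i) + z.1 + z.2 * e with hF
  have hcont : ContinuousOn F (Set.Icc lo hi ×ˢ Set.Icc 0 Λ) := by
    intro z hz
    refine ContinuousAt.continuousWithinAt ?_
    have hΨ : ∀ i, ContinuousAt (fun z : ℝ × ℝ => Ψ (z.1 + z.2 * Δ i)) z := by
      intro i
      have h1 : ContinuousAt Ψ ((fun z : ℝ × ℝ => z.1 + z.2 * Δ i) z) :=
        (O.deriv (hDlo _ hz.1.1 _ hz.2.1 i)).continuousAt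
      exact ContinuousAt.comp (f := fun z : ℝ × ℝ => z.1 + z.2 * Δ i) h1 (by fun_prop)
    have hsum : ContinuousAt (fun z : ℝ × ℝ => ∑ i, g i * Ψ (z.1 + z.2 * Δ i)) z :=
      tendsto_finsetSum _ fun i _ => (hΨ i).const_mul (g i)
    simp only [hF]
    fun_prop
  obtain ⟨⟨a, t⟩, ⟨ha, ht⟩, hmin⟩ := (isCompact_Icc.prod isCompact_Icc).exists_isMinOn
    ⟨(lo, 0), ⟨⟨le_rfl, hlohi.le⟩, ⟨le_rfl, hΛ0.le⟩⟩⟩ hcont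
  replace ha : a ∈ Set.Icc lo hi := ha
  replace ht : t ∈ Set.Icc 0 Λ := ht
  have hD := hDlo a ha.1 t ht.1
  have hda : HasDerivAt (fun a => F (a, t)) (1 - ∑ i, g i * φ (a + t * Δ i)) a := by
    have h1 : ∀ i ∈ Finset.univ, HasDerivAt (fun a => g i * Ψ (a + t * Δ i))
        (g i * -φ (a + t * Δ i)) a := fun i _ =>
      ((O.deriv (hD i)).comp_add_const a (t * Δ i)).const_mul (g i)
    have h2 := ((HasDerivAt.fun_sum h1).add (hasDerivAt_id a)).add_const (t * e)
    refine h2.congr_deriv ?_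
    simp only [mul_neg, Finset.sum_neg_distrib]
    ring
  have hdt : HasDerivAt (fun t => F (a, t)) (e - ∑ i, g i * Δ i * φ (a + t * Δ i)) t := by
    have h1 : ∀ i ∈ Finset.univ, HasDerivAt (fun t => g i * Ψ (a + t * Δ i))
        (g i * (-φ (a + t * Δ i) * Δ i)) t := fun i _ => by
      have h3 : HasDerivAt (fun t => a + t * Δ i) (Δ i) t := by
        simpa using ((hasDerivAt_id t).mul_const (Δ i)).const_add a
      exact ((O.deriv (hD i)).comp t h3).const_mul (g i)
    have h2 := ((HasDerivAt.fun_sum h1).add_const a).add ((hasDerivAt_id t).mul_const e)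
    refine h2.congr_deriv ?_
    rw [one_mul, add_comm, sub_eq_add_neg, ← Finset.sum_neg_distrib]
    congr 1
    exact Finset.sum_congr rfl fun i _ => by ring
  have hgφ : ∀ i, 0 < g i * φ (a + t * Δ i) := fun i => mul_pos (hg i) (O.pos (hD i))
  have hmina : IsMinOn (fun a => F (a, t)) (Set.Icc lo hi) a := fun w hw =>
    hmin (show (w, t) ∈ Set.Icc lo hi ×ˢ Set.Icc 0 Λ from ⟨hw, ht⟩)
  have hmint : IsMinOn (fun t => F (a, t)) (Set.Icc 0 Λ) t := fun w hw =>
    hmin (show (a, w) ∈ Set.Icc lo hi ×ˢ Set.Icc 0 Λ from ⟨ha, hw⟩)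
  have eq1 : 1 - ∑ i, g i * φ (a + t * Δ i) = 0 := by
    refine eq_zero_of_isMinOn_Icc hlohi ha hmina hda
      (fun h => ?_) (fun h => ?_)
    · have h1 : g i₀ * φ (a + t * Δ i₀) ≤ ∑ i, g i * φ (a + t * Δ i) :=
        Finset.single_le_sum (fun i _ => (hgφ i).le) (Finset.mem_univ i₀)
      have h2 : g i₀ * φ (a + t * Δ i₀) = 2 := by
        simp only [hΔ, sub_self, mul_zero, add_zero, h, hlo]
        exact mul_div_cancel₀ _ (hg i₀).ne'
      linarith
    · have h1 : ∑ i, g i * φ (a + t * Δ i) ≤ ∑ i, g i * y := by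
        refine Finset.sum_le_sum fun i _ => mul_le_mul_of_nonneg_left ?_ (hg i).le
        rw [← hhi]
        exact O.anti.antitoneOn hhiD (hD i) (by nlinarith [mul_nonneg ht.1 (hΔ0 i)])
      rw [← Finset.sum_mul, hg1, one_mul] at h1
      linarith
  have eq2 : e - ∑ i, g i * Δ i * φ (a + t * Δ i) = 0 := by
    refine eq_zero_of_isMinOn_Icc hΛ0 ht hmint hdt
      (fun h => ?_) (fun h => ?_)
    · have h1 : T * y ≤ ∑ i, g i * Δ i * φ (a + t * Δ i) := by
        rw [hT, Finset.sum_mul]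
        refine Finset.sum_le_sum fun i _ =>
          mul_le_mul_of_nonneg_left ?_ (mul_nonneg (hg i).le (hΔ0 i))
        rw [← hhi]
        exact O.anti.antitoneOn (hD i) hhiD (by rw [h]; linarith [ha.2])
      rw [div_lt_iff₀ hT0] at hy1
      linarith
    · have h1 : ∑ i, g i * Δ i * φ (a + t * Δ i) ≤ ∑ i, g i * Δ i * φ (lo + Λ * Δ i) := by
        refine Finset.sum_le_sum fun i _ =>
          mul_le_mul_of_nonneg_left ?_ (mul_nonneg (hg i).le (hΔ0 i))
        rw [h]
        exact O.anti.antitoneOn (hDlo lo le_rfl Λ hΛ0.le i) (hDlo a ha.1 Λ hΛ0.le i)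
          (by linarith [ha.1])
      linarith
  have harg : ∀ i, t * ε i + (a - t * ε i₀) = a + t * Δ i := fun i => by simp only [hΔ]; ring
  refine ⟨(t, a - t * ε i₀), fun i => ?_, ?_, ?_⟩
  · simp only [harg]
    exact hgφ i
  · simp only [harg]
    linarith
  · simp only [harg]
    have h1 : ∑ i, ε i * (g i * φ (a + t * Δ i)) =
        ∑ i, g i * Δ i * φ (a + t * Δ i) + ε i₀ * ∑ i, g i * φ (a + t * Δ i) := by
      rw [Finset.mul_sum, ← Finset.sum_add_distrib]
      refine Finset.sum_congr rfl fun i _ => ?_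
      simp only [hΔ]
      ring
    rw [h1, ← sub_eq_zero.1 eq1, ← sub_eq_zero.1 eq2, he]
    ring

lemma existsUnique_solves (O : OccupationFunction φ Ψ D) {m : ℕ} (hm : 0 < m) {g ε : Fin m → ℝ}
    (hg : ∀ i, 0 < g i) (hg1 : ∑ i, g i = 1) (hε : StrictMono ε) {E : ℝ}
    (hE0 : ε ⟨0, hm⟩ < E) (hE : E < ∑ i, g i * ε i) :
    ∃! p : ℝ × ℝ, SolvesConstraints ε E fun i => g i * φ (p.1 * ε i + p.2) := by
  obtain ⟨p, hp⟩ := O.exists_solves hm hg hg1 hε hE0 hE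
  have hm1 : 1 < m := by
    by_contra! h
    obtain rfl : m = 1 := by omega
    rw [Fin.sum_univ_one] at hg1
    rw [Fin.sum_univ_one, hg1, one_mul] at hE
    exact lt_asymm hE0 hE
  exact ⟨p, hp, fun p' hp' => O.solves_unique hg hε hm1 hp' hp⟩

end OccupationFunction

lemma occupationFunction_maxwellBoltzmann :
    OccupationFunction (fun a => 1 / Real.exp a) (fun a => Real.exp (-a)) Set.univ where
  up _ _ _ _ := Set.mem_univ _
  mem_of_pos _ _ := Set.mem_univ _
  pos _ _ := by positivity
  anti a _ b _ h := one_div_lt_one_div_of_lt (Real.exp_pos a) (Real.exp_lt_exp.2 h)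
  deriv a _ := by
    refine (hasDerivAt_neg a).exp.congr_deriv ?_
    rw [Real.exp_neg, one_div, mul_neg_one]
  surj y hy := ⟨-Real.log y, Set.mem_univ _, by
    rw [Real.exp_neg, Real.exp_log hy, one_div, inv_inv]⟩
  tendsto := by
    simp only [one_div]
    exact Real.tendsto_exp_atTop.inv_tendsto_atTop

lemma occupationFunction_boseEinstein {c : ℝ} (hc : 0 < c) :
    OccupationFunction (fun a => c / (Real.exp a - 1))
      (fun a => -(c * Real.log (1 - Real.exp (-a)))) (Set.Ioi 0) where
  up a b ha h := lt_of_lt_of_le ha h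
  mem_of_pos a h := by
    have h1 : 0 < Real.exp a - 1 := by
      by_contra! h1
      exact absurd h (not_lt.2 (div_nonpos_of_nonneg_of_nonpos hc.le h1))
    exact Real.one_lt_exp_iff.1 (by linarith)
  pos a ha := div_pos hc (sub_pos.2 (Real.one_lt_exp_iff.2 ha))
  anti a ha b _ h := div_lt_div_of_pos_left hc (sub_pos.2 (Real.one_lt_exp_iff.2 ha))
    (sub_lt_sub_right (Real.exp_lt_exp.2 h) 1)
  deriv a ha := by
    have h1 : 0 < Real.exp a - 1 := sub_pos.2 (Real.one_lt_exp_iff.2 ha)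
    have h2 : 1 - Real.exp (-a) = (Real.exp a - 1) / Real.exp a := by
      rw [Real.exp_neg]; field_simp
    have h3 : 1 - Real.exp (-a) ≠ 0 := by rw [h2]; positivity
    have h4 := ((((hasDerivAt_neg a).exp).const_sub 1).log h3).const_mul c |>.neg
    refine h4.congr_deriv ?_
    rw [h2, Real.exp_neg]
    field_simp
  surj y hy := ⟨Real.log (1 + c / y), Real.log_pos (by linarith [div_pos hc hy]), by
    have := div_pos hc hy
    rw [Real.exp_log (by linarith), add_sub_cancel_left]
    field_simp⟩
  tendsto := by
    have h : Tendsto (fun a => Real.exp a - 1) atTop atTop :=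
      tendsto_atTop_add_const_right _ (-1) Real.tendsto_exp_atTop
    exact h.const_div_atTop c

lemma occupationFunction_zipfMandelbrot :
    OccupationFunction (fun a : ℝ => 1 / a) (fun a => -Real.log a) (Set.Ioi 0) where
  up a b ha h := lt_of_lt_of_le ha h
  mem_of_pos a h := one_div_pos.1 h
  pos a ha := one_div_pos.2 ha
  anti a ha b _ h := one_div_lt_one_div_of_lt ha h
  deriv a ha := by
    simpa using! (Real.hasDerivAt_log (ne_of_gt ha)).neg
  surj y hy := ⟨1 / y, one_div_pos.2 hy, by simp⟩
  tendsto := tendsto_id.const_div_atTop 1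

lemma maxwellBoltzmann_eq {m : ℕ} (g ε : Fin m → ℝ) (p : ℝ × ℝ) :
    maxwellBoltzmann g ε p = fun i => g i * (1 / Real.exp (p.1 * ε i + p.2)) := by
  funext i
  rw [maxwellBoltzmann, mul_one_div]

lemma boseEinstein_eq {m : ℕ} (c : ℝ) (g ε : Fin m → ℝ) (p : ℝ × ℝ) :
    boseEinstein c g ε p = fun i => g i * (c / (Real.exp (p.1 * ε i + p.2) - 1)) := by
  funext i
  rw [boseEinstein, mul_div_assoc]

lemma zipfMandelbrot_eq {m : ℕ} (g ε : Fin m → ℝ) (p : ℝ × ℝ) :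
    zipfMandelbrot g ε p = fun i => g i * (1 / (p.1 * ε i + p.2)) := by
  funext i
  rw [zipfMandelbrot, mul_one_div]

/-! ### The three regimes -/

/-- The conditions on a limit point `x` with multiplier `lam` of the energy: `x` is a strictly
positive probability vector satisfying the energy constraint and complementary slackness. -/
structure IsOptimal {m : ℕ} (ε : Fin m → ℝ) (E : ℝ) (x : Fin m → ℝ) (lam : ℝ) : Prop where
  pos : ∀ i, 0 < x i
  sum_eq : ∑ i, x i = 1
  energy : ∑ i, ε i * x i ≤ E
  lam_nonneg : 0 ≤ lam
  slack : lam * (E - ∑ i, ε i * x i) = 0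

lemma SolvesConstraints.isOptimal {m : ℕ} {ε : Fin m → ℝ} {E : ℝ} {x : Fin m → ℝ} {lam : ℝ}
    (hx : SolvesConstraints ε E x) (hlam : 0 ≤ lam) : IsOptimal ε E x lam :=
  ⟨hx.1, hx.2.1, hx.2.2.le, hlam, by rw [hx.2.2, sub_self, mul_zero]⟩

lemma isOptimal_of_le {m : ℕ} {ε g : Fin m → ℝ} {E : ℝ} (hg : ∀ i, 0 < g i)
    (hg1 : ∑ i, g i = 1) (hE : ∑ i, g i * ε i ≤ E) : IsOptimal ε E g 0 :=
  ⟨hg, hg1, by simpa only [mul_comm] using hE, le_rfl, zero_mul _⟩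

lemma exists_pos_le {m : ℕ} {f : Fin m → ℝ} (hf : ∀ i, 0 < f i) :
    ∃ κ, 0 < κ ∧ ∀ i, κ ≤ f i := by
  have h : ∀ i, ∀ᶠ κ in 𝓝[>] (0 : ℝ), κ ≤ f i := fun i =>
    mem_nhdsWithin_of_mem_nhds (Iic_mem_nhds (hf i))
  obtain ⟨κ, h1, h2⟩ := ((eventually_all.2 h).and self_mem_nhdsWithin).exists
  exact ⟨κ, h2, h1⟩

/-- The level degeneracies `g_i G(N)` are positive integers, and `G(N) → ∞`. -/
structure Degeneracies {m : ℕ} (g : Fin m → ℝ) (G : ℕ → ℕ) (d : ℕ → Fin m → ℕ) : Prop where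
  pos_m : 0 < m
  pos : ∀ i, 0 < g i
  sum_eq : ∑ i, g i = 1
  G_pos : ∀ N, 0 < N → 0 < G N
  G_top : Tendsto G atTop atTop
  d_eq : ∀ N, 0 < N → ∀ i, (d N i : ℝ) = g i * (G N : ℝ)

namespace Degeneracies

variable {m : ℕ} {g : Fin m → ℝ} {G : ℕ → ℕ} {d : ℕ → Fin m → ℕ}

lemma d_pos (Dg : Degeneracies g G d) {N : ℕ} (hN : 0 < N) (i : Fin m) : 0 < d N i := by
  have h1 : (0 : ℝ) < G N := by exact_mod_cast Dg.G_pos N hN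
  have h2 : (0 : ℝ) < d N i := by
    rw [Dg.d_eq N hN i]
    exact mul_pos (Dg.pos i) h1
  exact_mod_cast h2

lemma g_le_one (Dg : Degeneracies g G d) (i : Fin m) : g i ≤ 1 := by
  rw [← Dg.sum_eq]
  exact Finset.single_le_sum (fun i _ => (Dg.pos i).le) (Finset.mem_univ i)

/-- A common positive lower bound for the `g_i` and `x_i`. -/
lemma exists_bound (Dg : Degeneracies g G d) {x : Fin m → ℝ} (hx : ∀ i, 0 < x i) :
    ∃ κ, 0 < κ ∧ κ ≤ 1 ∧ (∀ i, κ ≤ x i) ∧ ∀ i, κ ≤ g i := by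
  obtain ⟨κ, hκ, h⟩ := exists_pos_le fun i => lt_min (hx i) (Dg.pos i)
  have hκg : ∀ i, κ ≤ g i := fun i => (h i).trans (min_le_right _ _)
  exact ⟨κ, hκ, (hκg ⟨0, Dg.pos_m⟩).trans (Dg.g_le_one _), fun i => (h i).trans (min_le_left _ _),
    hκg⟩

/-- When `G(N) / N → ∞`, the parameter `ν` is shifted by `log (G(N) / N)`. -/
lemma regular_dilute (Dg : Degeneracies g G d) {ε : Fin m → ℝ} {E : ℝ} {p : ℝ × ℝ}
    (hG : Tendsto (fun N : ℕ => (G N : ℝ) / N) atTop atTop)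
    (hx : IsOptimal ε E (maxwellBoltzmann g ε p) p.1) :
    ∃ κ K C : ℝ, 0 ≤ C ∧ ∀ᶠ N : ℕ in atTop,
      Regular κ K ε E (maxwellBoltzmann g ε p) (d N) N 1 p.1 (p.2 + Real.log (G N / N))
        (C * (N / G N)) := by
  obtain ⟨κ, hκ, hκ1, hκx, hκg⟩ := Dg.exists_bound hx.pos
  have hlam := hx.lam_nonneg
  have hv : Tendsto (fun N : ℕ => (N : ℝ) / G N) atTop (𝓝 0) := by
    refine hG.inv_tendsto_atTop.congr fun N => ?_
    simp
  refine ⟨κ, 1 + p.1, 2 / κ, by positivity, ?_⟩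
  filter_upwards [hv.eventually_lt_const (by positivity : 0 < κ ^ 2 / 4),
    eventually_gt_atTop 0, tendsto_natCast_atTop_atTop.eventually_ge_atTop (4 * m / κ)]
    with N hvN hN hsize
  have hN' : (0 : ℝ) < N := by exact_mod_cast hN
  have hGN : (0 : ℝ) < G N := by exact_mod_cast Dg.G_pos N hN
  have hvN0 : 0 < (N : ℝ) / G N := by positivity
  have hratio : ∀ l, levelRatio ε p.1 (p.2 + Real.log (G N / N)) l =
      maxwellBoltzmann g ε p l / g l * (N / G N) := by
    intro l
    have := Dg.pos l
    rw [levelRatio, maxwellBoltzmann, ← add_assoc, neg_add, Real.exp_add, Real.exp_neg,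
      Real.exp_neg (Real.log _), Real.exp_log (by positivity)]
    field_simp
  have hx1 : ∀ l, maxwellBoltzmann g ε p l ≤ 1 := by
    intro l
    rw [← hx.sum_eq]
    exact Finset.single_le_sum (fun i _ => (hx.pos i).le) (Finset.mem_univ l)
  have hratio_le : ∀ l, levelRatio ε p.1 (p.2 + Real.log (G N / N)) l ≤ 1 / κ * (N / G N) := by
    intro l
    rw [hratio]
    gcongr
    exacts [hx1 l, hκg l]
  have hhalf : ∀ l, levelRatio ε p.1 (p.2 + Real.log (G N / N)) l ≤ 1 / 2 := by
    intro l
    refine (hratio_le l).trans ?_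
    rw [div_mul_eq_mul_div, one_mul, div_le_iff₀ hκ]
    nlinarith
  refine ⟨Dg.pos_m, hκ, by linarith, Dg.d_pos hN, le_rfl, hκx, hx.sum_eq, hx.energy, hlam,
    hx.slack, by linarith, fun l => (hhalf l).trans_lt (by norm_num), fun l => ?_, ?_,
    fun l => by linarith, fun l => ?_, ?_⟩
  · set ρ := levelRatio ε p.1 (p.2 + Real.log (G N / N)) l with hρ
    have hρ0 : 0 < ρ := levelRatio_pos _ _ _ _
    have hρ1 : 0 < 1 - ρ := by linarith [hhalf l]
    have hdρ : d N l * ρ = N * maxwellBoltzmann g ε p l := by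
      have := Dg.pos l
      rw [hρ, hratio, Dg.d_eq N hN]
      field_simp
    have h1 : levelMean ε (d N) p.1 (p.2 + Real.log (G N / N)) l -
        N * maxwellBoltzmann g ε p l = N * (maxwellBoltzmann g ε p l * (ρ / (1 - ρ))) := by
      rw [levelMean, ← hρ, hdρ]
      field_simp
      ring
    have h2 : ρ / (1 - ρ) ≤ 2 * ρ := by
      rw [div_le_iff₀ hρ1]
      nlinarith [hhalf l]
    have h3 := (hx.pos l).le
    rw [h1, abs_of_nonneg (by positivity)]
    refine mul_le_mul_of_nonneg_left ?_ hN'.le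
    calc maxwellBoltzmann g ε p l * (ρ / (1 - ρ)) ≤ 1 * (2 * ρ) := by
          gcongr
          exact hx1 l
      _ ≤ 1 * (2 * (1 / κ * (N / G N))) := by
          gcongr
          exact hratio_le l
      _ = _ := by ring
  · rw [div_mul_eq_mul_div, div_le_iff₀ hκ]
    nlinarith
  · rw [Dg.d_eq N hN, mul_one]
    rw [div_lt_iff₀ hGN] at hvN
    have h1 : κ * G N ≤ g l * G N := by gcongr; exact hκg l
    have h2 : κ ^ 2 / 4 ≤ κ := by nlinarith
    nlinarith [mul_nonneg hlam (mul_pos (Dg.pos l) hGN).le]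
  · rw [div_le_iff₀ hκ] at hsize
    linarith

/-- When `G(N) / N → c`, the multipliers do not depend on `N`, and the means are exactly
`N x_l` times `G(N) / (c N)`. -/
lemma regular_balanced (Dg : Degeneracies g G d) {ε : Fin m → ℝ} {E : ℝ} {p : ℝ × ℝ} {c : ℝ}
    (hc : 0 < c) (hG : Tendsto (fun N : ℕ => (G N : ℝ) / N) atTop (𝓝 c))
    (hx : IsOptimal ε E (boseEinstein c g ε p) p.1) :
    ∃ κ K : ℝ, ∀ᶠ N : ℕ in atTop,
      Regular κ K ε E (boseEinstein c g ε p) (d N) N 1 p.1 p.2 (1 / c * |(G N : ℝ) / N - c|) := by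
  obtain ⟨κ, hκ, hκ1, hκx, hκg⟩ := Dg.exists_bound hx.pos
  have hlam := hx.lam_nonneg
  have hv : Tendsto (fun N : ℕ => |(G N : ℝ) / N - c|) atTop (𝓝 0) := by
    simpa using (hG.sub_const c).abs
  refine ⟨κ, 1 + p.1 + 2 / (c * κ), ?_⟩
  filter_upwards [hv.eventually_lt_const (by positivity : 0 < c * (κ / 2)),
    eventually_gt_atTop 0, tendsto_natCast_atTop_atTop.eventually_ge_atTop (4 * m / κ)]
    with N hvN hN hsize
  have hN' : (0 : ℝ) < N := by exact_mod_cast hN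
  have hGN : (0 : ℝ) < G N := by exact_mod_cast Dg.G_pos N hN
  have hK : 0 < 2 / (c * κ) := by positivity
  have hexp : ∀ l, 0 < Real.exp (p.1 * ε l + p.2) - 1 := fun l =>
    sub_pos.2 (Real.one_lt_exp_iff.2 ((occupationFunction_boseEinstein hc).mem_of_pos
      (pos_of_mul_pos_right (by simpa [boseEinstein_eq] using hx.pos l) (Dg.pos l).le)))
  refine ⟨Dg.pos_m, hκ, by linarith, Dg.d_pos hN, le_rfl, hκx, hx.sum_eq, hx.energy, hlam,
    hx.slack, by linarith, fun l => ?_, fun l => ?_, ?_, fun l => by linarith, fun l => ?_, ?_⟩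
  · rw [levelRatio, Real.exp_neg]
    exact inv_lt_one_of_one_lt₀ (by linarith [hexp l])
  · have h1 : levelMean ε (d N) p.1 p.2 l - N * boseEinstein c g ε p l =
        N * (boseEinstein c g ε p l * (1 / c * ((G N : ℝ) / N - c))) := by
      have h2 := hexp l
      have h3 : 1 - Real.exp (-(p.1 * ε l + p.2)) =
          (Real.exp (p.1 * ε l + p.2) - 1) / Real.exp (p.1 * ε l + p.2) := by
        rw [Real.exp_neg]; field_simp
      rw [levelMean, levelRatio, h3, Real.exp_neg, boseEinstein, Dg.d_eq N hN]
      field_simp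
    have hx1 : boseEinstein c g ε p l ≤ 1 := by
      rw [← hx.sum_eq]
      exact Finset.single_le_sum (fun i _ => (hx.pos i).le) (Finset.mem_univ l)
    rw [h1, abs_mul, abs_mul, abs_mul, abs_of_pos hN', abs_of_pos (hx.pos l),
      abs_of_pos (by positivity : 0 < 1 / c)]
    refine mul_le_mul_of_nonneg_left ?_ hN'.le
    exact mul_le_of_le_one_left (by positivity) hx1
  · rw [one_div, inv_mul_le_iff₀ hc]
    exact hvN.le
  · have h1 : c / 2 * N ≤ G N := by
      have h2 := (abs_lt.1 hvN).1
      have h3 : c / 2 ≤ (G N : ℝ) / N := by nlinarith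
      rwa [le_div_iff₀ hN'] at h3
    have h4 : c / 2 * N * κ ≤ G N * g l := mul_le_mul h1 (hκg l) hκ.le hGN.le
    have h5 : (N : ℝ) ≤ 2 / (c * κ) * (g l * G N) := by
      rw [div_mul_eq_mul_div, le_div_iff₀ (by positivity)]
      linarith
    have h6 := mul_pos (Dg.pos l) hGN
    rw [Dg.d_eq N hN, mul_one]
    nlinarith [mul_nonneg hlam h6.le]
  · rw [div_le_iff₀ hκ] at hsize
    linarith

lemma abs_div_exp_sub_one_sub_one_le {y : ℝ} (h0 : 0 < y) (h1 : y ≤ 1) :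
    |y / (Real.exp y - 1) - 1| ≤ y := by
  have h2 : y + 1 ≤ Real.exp y := Real.add_one_le_exp y
  have h3 : Real.exp y - 1 - y ≤ y ^ 2 :=
    (abs_le.1 (Real.abs_exp_sub_one_sub_id_le (by rwa [abs_of_pos h0]))).2
  have h4 : 0 < Real.exp y - 1 := by linarith
  rw [abs_le]
  constructor
  · rw [le_sub_iff_add_le, le_div_iff₀ h4]
    nlinarith
  · rw [sub_le_iff_le_add, div_le_iff₀ h4]
    nlinarith

/-- When `G(N) / N → 0`, the parameters `λ` and `ν` are multiplied by `G(N) / N`, and the width is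
`N / G(N)`. -/
lemma regular_dense (Dg : Degeneracies g G d) {ε : Fin m → ℝ} {E : ℝ} {p : ℝ × ℝ}
    (hG : Tendsto (fun N : ℕ => (G N : ℝ) / N) atTop (𝓝 0))
    (hx : IsOptimal ε E (zipfMandelbrot g ε p) p.1) :
    ∃ κ K : ℝ, ∀ᶠ N : ℕ in atTop,
      Regular κ K ε E (zipfMandelbrot g ε p) (d N) N (N / G N) (p.1 * (G N / N))
        (p.2 * (G N / N)) (G N / N) := by
  obtain ⟨κ, hκ, hκ1, hκx, hκg⟩ := Dg.exists_bound hx.pos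
  have hlam := hx.lam_nonneg
  refine ⟨κ, 1 + p.1 + 1 / κ, ?_⟩
  filter_upwards [hG.eventually_lt_const (by positivity : 0 < κ / 2), eventually_gt_atTop 0,
    (tendsto_natCast_atTop_atTop.comp Dg.G_top).eventually_ge_atTop (4 * m / κ)]
    with N hvN hN hsize
  have hN' : (0 : ℝ) < N := by exact_mod_cast hN
  have hGN : (0 : ℝ) < G N := by exact_mod_cast Dg.G_pos N hN
  have hK : 0 < 1 / κ := by positivity
  have hx1 : ∀ l, zipfMandelbrot g ε p l ≤ 1 := by
    intro l
    rw [← hx.sum_eq]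
    exact Finset.single_le_sum (fun i _ => (hx.pos i).le) (Finset.mem_univ l)
  have hτ0 : 0 < (G N : ℝ) / N := by positivity
  have ha : ∀ l, 0 < p.1 * ε l + p.2 := fun l =>
    occupationFunction_zipfMandelbrot.mem_of_pos
      (pos_of_mul_pos_right (by simpa [zipfMandelbrot_eq] using hx.pos l) (Dg.pos l).le)
  have hratio : ∀ l, levelRatio ε (p.1 * (G N / N)) (p.2 * (G N / N)) l =
      Real.exp (-((p.1 * ε l + p.2) * (G N / N))) := by
    intro l
    rw [levelRatio]
    congr 1
    ring
  refine ⟨Dg.pos_m, hκ, by linarith, Dg.d_pos hN, ?_, hκx, hx.sum_eq, hx.energy, by positivity,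
    ?_, ?_, fun l => ?_, fun l => ?_, hvN.le, fun l => ?_, fun l => ?_, ?_⟩
  · rw [one_le_div₀ hGN]
    rw [div_lt_iff₀ hN'] at hvN
    nlinarith
  · rw [mul_right_comm, hx.slack, zero_mul]
  · rw [show p.1 * ((G N : ℝ) / N) * (N / G N) = p.1 by field_simp]
    linarith
  · rw [hratio]
    exact Real.exp_lt_one_iff.2 (neg_lt_zero.2 (mul_pos (ha l) hτ0))
  · have hal := ha l
    set y := (p.1 * ε l + p.2) * ((G N : ℝ) / N) with hy
    have hy0 : 0 < y := mul_pos hal hτ0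
    have hxl : zipfMandelbrot g ε p l * y = g l * (G N / N) := by
      rw [zipfMandelbrot, hy]
      field_simp
    have hy1 : y ≤ 1 := by
      have h1 : κ * y ≤ g l * (G N / N) := by
        rw [← hxl]
        gcongr
        exact hκx l
      nlinarith [Dg.g_le_one l]
    have hey : 0 < Real.exp y - 1 := sub_pos.2 (Real.one_lt_exp_iff.2 hy0)
    have h1 : levelMean ε (d N) (p.1 * (G N / N)) (p.2 * (G N / N)) l -
        N * zipfMandelbrot g ε p l = N * (zipfMandelbrot g ε p l * (y / (Real.exp y - 1) - 1)) := by
      have h2 : 1 - Real.exp (-y) = (Real.exp y - 1) / Real.exp y := by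
        rw [Real.exp_neg]; field_simp
      have h3 : (d N l : ℝ) = N * (zipfMandelbrot g ε p l * y) := by
        rw [hxl, Dg.d_eq N hN]; field_simp
      rw [levelMean, hratio, ← hy, h2, Real.exp_neg, h3]
      field_simp
    rw [h1, abs_mul, abs_mul, abs_of_pos hN', abs_of_pos (hx.pos l)]
    refine mul_le_mul_of_nonneg_left ?_ hN'.le
    calc _ ≤ zipfMandelbrot g ε p l * y :=
          mul_le_mul_of_nonneg_left (abs_div_exp_sub_one_sub_one_le hy0 hy1) (hx.pos l).le
      _ = g l * (G N / N) := hxl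
      _ ≤ _ := mul_le_of_le_one_left hτ0.le (Dg.g_le_one l)
  · rw [Dg.d_eq N hN, show (N : ℝ) / G N * (g l * G N) = g l * N by field_simp]
    nlinarith [Dg.g_le_one l, mul_pos (Dg.pos l) hGN]
  · rw [Dg.d_eq N hN, mul_assoc, show (N : ℝ) / G N * (g l * G N) = g l * N by field_simp]
    have h1 : κ * N ≤ g l * N := by gcongr; exact hκg l
    have h2 : (N : ℝ) ≤ 1 / κ * (g l * N) := by
      rw [div_mul_eq_mul_div, le_div_iff₀ hκ]
      linarith
    nlinarith [mul_nonneg hlam (mul_pos (Dg.pos l) hN').le, mul_pos (Dg.pos l) hN']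
  · have h1 : 4 * m / κ ≤ (G N : ℝ) := hsize
    rw [div_le_iff₀ hκ] at h1
    rw [mul_div_assoc', div_le_iff₀ hGN]
    nlinarith

lemma weakLawDilute (Dg : Degeneracies g G d) {ε : Fin m → ℝ} (hε : StrictMono ε) {E : ℝ}
    {r : ℕ} (hr : r ≤ 1) {p : ℝ × ℝ} (hG : Tendsto (fun N : ℕ => (G N : ℝ) / N) atTop atTop)
    (hx : IsOptimal ε E (maxwellBoltzmann g ε p) p.1) :
    WeakLawDilute G (fun N => law r ε E (d N) N) (maxwellBoltzmann g ε p) := by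
  obtain ⟨κ, K, C, hC, hR⟩ := Dg.regular_dilute hG hx
  have hv : Tendsto (fun N : ℕ => (N : ℝ) / G N) atTop (𝓝 0) := by
    refine hG.inv_tendsto_atTop.congr fun N => ?_
    simp
  obtain ⟨h1, h2⟩ := convergesToConst_and_mgfRate hε hr hR (s := fun N => (N : ℝ))
    (by simp) tendsto_natCast_atTop_atTop (Eventually.of_forall fun N => by positivity)
    (by simpa using hv.const_mul C)
  exact ⟨h1, h2 _ ((isBigO_refl _ _).const_mul_left C)⟩

lemma weakLawBalanced (Dg : Degeneracies g G d) {ε : Fin m → ℝ} (hε : StrictMono ε) {E : ℝ}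
    {r : ℕ} (hr : r ≤ 1) {p : ℝ × ℝ} {c : ℝ} (hc : 0 < c)
    (hG : Tendsto (fun N : ℕ => (G N : ℝ) / N) atTop (𝓝 c))
    (hx : IsOptimal ε E (boseEinstein c g ε p) p.1) :
    WeakLawBalanced c G (fun N => law r ε E (d N) N) (boseEinstein c g ε p) := by
  obtain ⟨κ, K, hR⟩ := Dg.regular_balanced hc hG hx
  have hv : Tendsto (fun N : ℕ => |(G N : ℝ) / N - c|) atTop (𝓝 0) := by
    simpa using (hG.sub_const c).abs
  obtain ⟨h1, h2⟩ := convergesToConst_and_mgfRate hε hr hR (s := fun N => (N : ℝ))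
    (by simp) tendsto_natCast_atTop_atTop (Eventually.of_forall fun N => by positivity)
    (by simpa using hv.const_mul (1 / c))
  exact ⟨h1, fun w _ _ hw => h2 w (hw.abs_left.const_mul_left (1 / c))⟩

lemma weakLawDense (Dg : Degeneracies g G d) {ε : Fin m → ℝ} (hε : StrictMono ε) {E : ℝ}
    {r : ℕ} (hr : r ≤ 1) {p : ℝ × ℝ} (hG : Tendsto (fun N : ℕ => (G N : ℝ) / N) atTop (𝓝 0))
    (hx : IsOptimal ε E (zipfMandelbrot g ε p) p.1) :
    WeakLawDense G (fun N => law r ε E (d N) N) (zipfMandelbrot g ε p) := by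
  obtain ⟨κ, K, hR⟩ := Dg.regular_dense hG hx
  obtain ⟨h1, h2⟩ := convergesToConst_and_mgfRate hε hr hR (s := fun N => (G N : ℝ)) (by
      filter_upwards [eventually_gt_atTop 0] with N hN
      have hN' : (0 : ℝ) < N := by exact_mod_cast hN
      rw [div_div_cancel₀ hN'.ne'])
    (tendsto_natCast_atTop_atTop.comp Dg.G_top) (Eventually.of_forall fun N => by positivity) hG
  exact ⟨h1, h2 _ (isBigO_refl _ _)⟩

end Degeneracies

lemma maxwellBoltzmann_zero {m : ℕ} (g ε : Fin m → ℝ) : maxwellBoltzmann g ε (0, 0) = g := by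
  funext i
  simp [maxwellBoltzmann]

lemma boseEinstein_zero {m : ℕ} (g ε : Fin m → ℝ) {c : ℝ} (hc : 0 < c) :
    boseEinstein c g ε (0, Real.log (1 + c)) = g := by
  funext i
  simp only [boseEinstein, zero_mul, zero_add]
  rw [Real.exp_log (by linarith), add_sub_cancel_left, mul_div_cancel_right₀ _ hc.ne']

lemma zipfMandelbrot_zero {m : ℕ} (g ε : Fin m → ℝ) : zipfMandelbrot g ε (0, 1) = g := by
  funext i
  simp [zipfMandelbrot]

end BoseGas

theorem theorem1 {m : ℕ} (hm : 0 < m) (r : ℕ) (hr : r ≤ 1)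
    (ε g : Fin m → ℝ) (hε : StrictMono ε) (hg : ∀ i, 0 < g i) (hg1 : ∑ i, g i = 1)
    (E : ℝ)
    (G : ℕ → ℕ) (hGpos : ∀ N, 0 < N → 0 < G N) (hGmono : Monotone G)
    (hGtop : Tendsto G atTop atTop)
    (d : ℕ → Fin m → ℕ) (hd : ∀ N, 0 < N → ∀ i, (d N i : ℝ) = g i * (G N : ℝ)) :
    (Tendsto (fun N : ℕ => (G N : ℝ) / (N : ℝ)) atTop atTop →
      (ε ⟨0, hm⟩ < E → E < ∑ i, g i * ε i →
        (∃! p : ℝ × ℝ, BoseGas.SolvesConstraints ε E (BoseGas.maxwellBoltzmann g ε p)) ∧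
        ∀ p : ℝ × ℝ, BoseGas.SolvesConstraints ε E (BoseGas.maxwellBoltzmann g ε p) →
          BoseGas.WeakLawDilute G (fun N => BoseGas.law r ε E (d N) N)
            (BoseGas.maxwellBoltzmann g ε p)) ∧
      (∑ i, g i * ε i ≤ E →
        BoseGas.WeakLawDilute G (fun N => BoseGas.law r ε E (d N) N) g)) ∧
    (∀ c : ℝ, 0 < c → Tendsto (fun N : ℕ => (G N : ℝ) / (N : ℝ)) atTop (𝓝 c) →
      (ε ⟨0, hm⟩ < E → E < ∑ i, g i * ε i →
        (∃! p : ℝ × ℝ, BoseGas.SolvesConstraints ε E (BoseGas.boseEinstein c g ε p)) ∧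
        ∀ p : ℝ × ℝ, BoseGas.SolvesConstraints ε E (BoseGas.boseEinstein c g ε p) →
          BoseGas.WeakLawBalanced c G (fun N => BoseGas.law r ε E (d N) N)
            (BoseGas.boseEinstein c g ε p)) ∧
      (∑ i, g i * ε i ≤ E →
        BoseGas.WeakLawBalanced c G (fun N => BoseGas.law r ε E (d N) N) g)) ∧
    (Tendsto (fun N : ℕ => (G N : ℝ) / (N : ℝ)) atTop (𝓝 0) →
      (ε ⟨0, hm⟩ < E → E < ∑ i, g i * ε i →
        (∃! p : ℝ × ℝ, BoseGas.SolvesConstraints ε E (BoseGas.zipfMandelbrot g ε p)) ∧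
        ∀ p : ℝ × ℝ, BoseGas.SolvesConstraints ε E (BoseGas.zipfMandelbrot g ε p) →
          BoseGas.WeakLawDense G (fun N => BoseGas.law r ε E (d N) N)
            (BoseGas.zipfMandelbrot g ε p)) ∧
      (∑ i, g i * ε i ≤ E →
        BoseGas.WeakLawDense G (fun N => BoseGas.law r ε E (d N) N) g)) := by
  have Dg : BoseGas.Degeneracies g G d := ⟨hm, hg, hg1, hGpos, hGtop, hd⟩
  refine ⟨fun hG => ⟨fun hE0 hE => ?_, fun hE => ?_⟩,
    fun c hc hG => ⟨fun hE0 hE => ?_, fun hE => ?_⟩, fun hG => ⟨fun hE0 hE => ?_, fun hE => ?_⟩⟩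
  · have O := BoseGas.occupationFunction_maxwellBoltzmann
    refine ⟨?_, fun p hp => Dg.weakLawDilute hε hr hG (hp.isOptimal ?_)⟩
    · simp only [BoseGas.maxwellBoltzmann_eq]
      exact O.existsUnique_solves hm hg hg1 hε hE0 hE
    · rw [BoseGas.maxwellBoltzmann_eq] at hp
      exact O.multiplier_nonneg hg hg1 hE hp
  · have h := Dg.weakLawDilute hε hr (p := (0, 0)) hG (E := E) (by
      rw [BoseGas.maxwellBoltzmann_zero]
      exact BoseGas.isOptimal_of_le hg hg1 hE)
    rwa [BoseGas.maxwellBoltzmann_zero] at h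
  · have O := BoseGas.occupationFunction_boseEinstein hc
    refine ⟨?_, fun p hp => Dg.weakLawBalanced hε hr hc hG (hp.isOptimal ?_)⟩
    · simp only [BoseGas.boseEinstein_eq]
      exact O.existsUnique_solves hm hg hg1 hε hE0 hE
    · rw [BoseGas.boseEinstein_eq] at hp
      exact O.multiplier_nonneg hg hg1 hE hp
  · have h := Dg.weakLawBalanced hε hr (p := (0, Real.log (1 + c))) hc hG (E := E) (by
      rw [BoseGas.boseEinstein_zero g ε hc]
      exact BoseGas.isOptimal_of_le hg hg1 hE)
    rwa [BoseGas.boseEinstein_zero g ε hc] at h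
  · have O := BoseGas.occupationFunction_zipfMandelbrot
    refine ⟨?_, fun p hp => Dg.weakLawDense hε hr hG (hp.isOptimal ?_)⟩
    · simp only [BoseGas.zipfMandelbrot_eq]
      exact O.existsUnique_solves hm hg hg1 hε hE0 hE
    · rw [BoseGas.zipfMandelbrot_eq] at hp
      exact O.multiplier_nonneg hg hg1 hE hp
  · have h := Dg.weakLawDense hε hr (p := (0, 1)) hG (E := E) (by
      rw [BoseGas.zipfMandelbrot_zero]
      exact BoseGas.isOptimal_of_le hg hg1 hE)
    rwa [BoseGas.zipfMandelbrot_zero] at h
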